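/- Let $p$ be a prime, $r\ge 0$, and let $G$ be a cyclic group of order $p^r$, with $H_k\le G$ the subgroup of order $p^k$ ($0\le k\le r$). Let $\Omega=\Omega_G$ be the Burnside Tambara functor: $\Omega(X)$ is the Grothendieck ring of finite $G$-sets over the finite $G$-set $X$, and for a $G$-map $f\colon X\to Y$, the restriction $f^*$ is given by fibre products, the additive transfer $f_+$ by composition with $f$, and the multiplicative transfer $f_\bullet$ is the unique polynomial map $\Omega(X)\to\Omega(Y)$ with $f_\bullet[A\xrightarrow{\pi}X]=[\Pi_f(A)\to Y]$, where $\Pi_f(A)$ is the set of pairs $(y,\sigma)$ with $y\in Y$ and $\sigma\colon f^{-1}(y)\to A$ a map satisfying $\pi\sigma=\mathrm{id}$. An ideal $\mathscr I$ of $\Omega$ is a family of ideals $\mathscr I(X)\subseteq\Omega(X)$, for all finite $G$-sets $X$, such that $f^*(\mathscr I(Y))\subseteq\mathscr I(X)$, $f_+(\mathscr I(X))\subseteq\mathscr I(Y)$ and $f_\bullet(\mathscr I(X))\subseteq f_\bullet(0)+\mathscr I(Y)$ for every $f\colon X\to Y$. It is prime if $\mathscr I\ne\Omega$ and, for all transitive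 $X,Y$ and all $a\in\Omega(X)$, $b\in\Omega(Y)$, one has $a\in\mathscr I(X)$ or $b\in\mathscr I(Y)$ if and only if $(v_\bullet w^*a-v_\bullet 0)(v'_\bullet w'^*b-v'_\bullet 0)\in\mathscr I(C)$ for all diagrams $C\xleftarrow{v}D\xrightarrow{w}X$ and $C\xleftarrow{v'}D'\xrightarrow{w'}Y$ of finite $G$-sets. Let $\mathrm{Spec}\,\Omega$ be the set of prime ideals, ordered by inclusion. Put $R_k=\Omega(G/H_k)$, and let $\mathrm{res}$, $\mathrm{ind}$, $\mathrm{jnd}$ be $f^*$, $f_+$, $f_\bullet$ for the projection $f\colon G/H_{k-1}\to G/H_k$. For an ideal $I\subseteq R_{k-1}$ let $L(I)=\mathrm{res}^{-1}(I)\subseteq R_k$, and let $S(I)\subseteq R_k$ be the ideal generated by $\mathrm{ind}(I)\cup\mathrm{jnd}(I)$. For a prime number $q\ne p$ and $0\le j\le r$, write $\mathcal L^j\mathcal S^{r-j}(q)$ for the ideal $\mathscr I$ of $\Omega$ with $\mathscr I(G/H_0)=(q)$, $\mathscr I(G/H_k)=S(\mathscr I(G/H_{k-1}))$ for $1\le k\le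 r-j$, and $\mathscr I(G/H_k)=L(\mathscr I(G/H_{k-1}))$ for $r-j<k\le r$ (an ideal of $\Omega$ is determined by its values on the $G/H_k$). Then every chain $\mathscr P_0\subsetneq\mathscr P_1\subsetneq\cdots\subsetneq\mathscr P_n$ in $\mathrm{Spec}\,\Omega$ has length $n\le r+1$, and for every prime number $q\ne p$ $$0\subsetneq\mathcal S^r(q)\subsetneq\mathcal L\mathcal S^{r-1}(q)\subsetneq\cdots\subsetneq\mathcal L^r(q)$$ is a chain of prime ideals of $\Omega$ of length $r+1$. Hence $\dim\mathrm{Spec}\,\Omega=r+1$, where the dimension is the supremum of the lengths of chains of prime ideals. -/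

import Mathlib

universe u

/-- A finite `G`-set over the `G`-set `X`: an object of the category `G-set / X`. -/
structure GSetOver (G : Type u) [Group G] (X : Type u) [MulAction G X] : Type (u + 1) where
  carrier : Type u
  [action : MulAction G carrier]
  [finite : Finite carrier]
  map : carrier →[G] X

namespace GSetOver

attribute [instance] GSetOver.action GSetOver.finite

variable {G : Type u} [Group G] {X Y Z : Type u} [MulAction G X] [MulAction G Y] [MulAction G Z]

/-- Isomorphism in `G-set / X`. -/
def Iso (A B : GSetOver G X) : Prop :=
  ∃ e : A.carrier ≃ B.carrier, (∀ (g : G) a, e (g • a) = g • e a) ∧ ∀ a, B.map (e a) = A.map a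

theorem Iso.refl (A : GSetOver G X) : Iso A A := ⟨Equiv.refl _, fun _ _ => rfl, fun _ => rfl⟩

theorem Iso.symm {A B : GSetOver G X} : Iso A B → Iso B A := by
  rintro ⟨e, h1, h2⟩
  refine ⟨e.symm, fun g b => ?_, fun b => ?_⟩
  · rw [Equiv.symm_apply_eq, h1, Equiv.apply_symm_apply]
  · rw [← h2, Equiv.apply_symm_apply]

theorem Iso.trans {A B C : GSetOver G X} : Iso A B → Iso B C → Iso A C := by
  rintro ⟨e, h1, h2⟩ ⟨e', h1', h2'⟩
  exact ⟨e.trans e', fun g b => by simp [h1, h1'], fun b => by simp [h2, h2']⟩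

instance setoid (G : Type u) [Group G] (X : Type u) [MulAction G X] : Setoid (GSetOver G X) where
  r := Iso
  iseqv := ⟨Iso.refl, Iso.symm, Iso.trans⟩

theorem Iso.of_bijective {A B : GSetOver G X} (e : A.carrier → B.carrier)
    (he : Function.Bijective e) (h1 : ∀ (g : G) a, e (g • a) = g • e a)
    (h2 : ∀ a, B.map (e a) = A.map a) : Iso A B :=
  ⟨Equiv.ofBijective e he, h1, h2⟩

/-- The initial object of `G-set / X`. -/
def empty : GSetOver G X :=
  letI : MulAction G PEmpty.{u + 1} :=
    { smul := fun _ a => a, one_smul := fun _ => rfl, mul_smul := fun _ _ _ => rfl }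
  { carrier := PEmpty
    map := { toFun := fun a => a.elim, map_smul' := fun _ a => a.elim } }

/-- The disjoint union, which is the coproduct of `G-set / X`. -/
def sum (A B : GSetOver G X) : GSetOver G X where
  carrier := A.carrier ⊕ B.carrier
  map :=
    { toFun := Sum.elim A.map B.map
      map_smul' := by rintro g (a | b) <;> simp }

/-- The terminal object `id : X → X` of `G-set / X`. -/
def terminal [Finite X] : GSetOver G X where
  carrier := X
  map := MulActionHom.id G

/-- The fibre product over `X`, which is the product of `G-set / X`. -/
def prod (A B : GSetOver G X) : GSetOver G X where
  carrier := ({ carrier := {z | A.map z.1 = B.map z.2}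
                smul_mem' := fun g z (hz : _ = _) => by simp [hz] } :
    SubMulAction G (A.carrier × B.carrier))
  map :=
    { toFun := fun z => A.map z.1.1
      map_smul' := fun g z => by simp }

/-- The pullback of `A → Y` along `f : X → Y`. -/
def pullback [Finite X] (f : X →[G] Y) (A : GSetOver G Y) : GSetOver G X where
  carrier := ({ carrier := {z | f z.1 = A.map z.2}
                smul_mem' := fun g z (hz : _ = _) => by simp [hz] } :
    SubMulAction G (X × A.carrier))
  map :=
    { toFun := fun z => z.1.1
      map_smul' := fun g z => by simp }

/-- Composition with `f : X → Y`. -/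
def pushforward (f : X →[G] Y) (A : GSetOver G X) : GSetOver G Y where
  carrier := A.carrier
  map := f.comp A.map

/-- An element `(y, σ)` of `Π_f(A)`: a point `y` of `Y` and a section `σ : f⁻¹(y) → A` of the
structure map `A → X` over the fibre `f⁻¹(y)`. -/
structure Section (f : X →[G] Y) (A : GSetOver G X) : Type u where
  pt : Y
  toFun : ∀ x, f x = pt → A.carrier
  map_toFun : ∀ x h, A.map (toFun x h) = x

namespace Section

variable {f : X →[G] Y} {A B : GSetOver G X}

theorem ext' {s t : Section f A} (h : s.pt = t.pt)
    (h' : ∀ x hs ht, s.toFun x hs = t.toFun x ht) : s = t := by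
  obtain ⟨y, σ, hσ⟩ := s
  obtain ⟨y', τ, hτ⟩ := t
  obtain rfl : y = y' := h
  obtain rfl : σ = τ := by
    funext x hx
    exact h' x hx hx
  rfl

theorem toFun_congr (s : Section f A) {x x' : X} (h : x = x') (hx : f x = s.pt)
    (hx' : f x' = s.pt) : s.toFun x hx = s.toFun x' hx' := by
  subst h; rfl

/-- `g • (y, σ) = (g • y, x ↦ g • σ (g⁻¹ • x))`. -/
instance : MulAction G (Section f A) where
  smul g s :=
    { pt := g • s.pt
      toFun := fun x hx => g • s.toFun (g⁻¹ • x) (by rw [map_smul, hx, inv_smul_smul])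
      map_toFun := fun x hx => by rw [map_smul, s.map_toFun, smul_inv_smul] }
  one_smul s := ext' (one_smul G s.pt) fun x hs ht => by
    change (1 : G) • s.toFun _ _ = _
    rw [one_smul]
    exact s.toFun_congr (by simp) _ _
  mul_smul g h s := ext' (mul_smul g h s.pt) fun x hs ht => by
    change (g * h) • s.toFun _ _ = g • h • s.toFun _ _
    rw [mul_smul, s.toFun_congr (show (g * h)⁻¹ • x = h⁻¹ • g⁻¹ • x by simp [mul_smul])]

theorem smul_pt (g : G) (s : Section f A) : (g • s).pt = g • s.pt := rfl

theorem smul_toFun (g : G) (s : Section f A) (x : X) (hx : f x = (g • s).pt) :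
    (g • s).toFun x hx = g • s.toFun (g⁻¹ • x) (by rw [map_smul, hx, smul_pt, inv_smul_smul]) :=
  rfl

instance [Finite X] [Finite Y] : Finite (Section f A) := by
  refine Finite.of_injective
    (β := Σ y : Y, ∀ x, f x = y → A.carrier) (fun s => ⟨s.pt, s.toFun⟩) ?_
  rintro ⟨y, σ, hσ⟩ ⟨y', τ, hτ⟩ h
  cases h
  rfl

end Section

/-- The `G`-set `Π_f(A)` over `Y`. -/
def sections [Finite X] [Finite Y] (f : X →[G] Y) (A : GSetOver G X) : GSetOver G Y where
  carrier := Section f A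
  map := { toFun := Section.pt, map_smul' := fun _ _ => rfl }

/-! ### Compatibility of the constructions with isomorphisms -/

theorem Iso.sum {A A' B B' : GSetOver G X} (h : Iso A A') (h' : Iso B B') :
    Iso (A.sum B) (A'.sum B') := by
  obtain ⟨e, h1, h2⟩ := h
  obtain ⟨e', h1', h2'⟩ := h'
  refine ⟨Equiv.sumCongr e e', ?_, ?_⟩
  · rintro g (a | b)
    · exact congrArg Sum.inl (h1 g a)
    · exact congrArg Sum.inr (h1' g b)
  · rintro (a | b)
    · exact h2 a
    · exact h2' b

theorem Iso.prod {A A' B B' : GSetOver G X} (h : Iso A A') (h' : Iso B B') :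
    Iso (A.prod B) (A'.prod B') := by
  obtain ⟨e, h1, h2⟩ := h
  obtain ⟨e', h1', h2'⟩ := h'
  refine ⟨⟨fun z => ⟨(e z.1.1, e' z.1.2), (h2 _).trans (z.2.trans (h2' _).symm)⟩,
    fun z => ⟨(e.symm z.1.1, e'.symm z.1.2), ?_⟩, ?_, ?_⟩, ?_, fun z => h2 z.1.1⟩
  · change A.map _ = B.map _
    rw [← h2, ← h2', e.apply_symm_apply, e'.apply_symm_apply]
    exact z.2
  · exact fun z => Subtype.ext (Prod.ext (e.symm_apply_apply _) (e'.symm_apply_apply _))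
  · exact fun z => Subtype.ext (Prod.ext (e.apply_symm_apply _) (e'.apply_symm_apply _))
  · exact fun g z => Subtype.ext (Prod.ext (h1 g _) (h1' g _))

theorem Iso.pullback [Finite X] (f : X →[G] Y) {A A' : GSetOver G Y} (h : Iso A A') :
    Iso (A.pullback f) (A'.pullback f) := by
  obtain ⟨e, h1, h2⟩ := h
  refine ⟨⟨fun z => ⟨(z.1.1, e z.1.2), z.2.trans (h2 _).symm⟩,
    fun z => ⟨(z.1.1, e.symm z.1.2), ?_⟩, ?_, ?_⟩, ?_, fun _ => rfl⟩
  · change f _ = A.map _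
    rw [← h2, e.apply_symm_apply]
    exact z.2
  · exact fun z => Subtype.ext (Prod.ext rfl (e.symm_apply_apply _))
  · exact fun z => Subtype.ext (Prod.ext rfl (e.apply_symm_apply _))
  · exact fun g z => Subtype.ext (Prod.ext rfl (h1 g _))

theorem Iso.pushforward (f : X →[G] Y) {A A' : GSetOver G X} (h : Iso A A') :
    Iso (A.pushforward f) (A'.pushforward f) := by
  obtain ⟨e, h1, h2⟩ := h
  exact ⟨e, h1, fun a => congrArg f (h2 a)⟩

/-- Postcomposition of sections with a map over `X`. -/
def Section.postcomp {f : X →[G] Y} {A B : GSetOver G X} (e : A.carrier → B.carrier)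
    (he : ∀ a, B.map (e a) = A.map a) (s : Section f A) : Section f B where
  pt := s.pt
  toFun := fun x hx => e (s.toFun x hx)
  map_toFun := fun x hx => (he _).trans (s.map_toFun x hx)

theorem Section.postcomp_smul {f : X →[G] Y} {A B : GSetOver G X} (e : A.carrier → B.carrier)
    (he : ∀ a, B.map (e a) = A.map a) (hg : ∀ (g : G) a, e (g • a) = g • e a) (g : G)
    (s : Section f A) : (g • s).postcomp e he = g • s.postcomp e he :=
  Section.ext' rfl fun _ _ _ => hg _ _

theorem Section.postcomp_injective {f : X →[G] Y} {A B : GSetOver G X}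
    (e : A.carrier → B.carrier) (he : ∀ a, B.map (e a) = A.map a) (hi : Function.Injective e) :
    Function.Injective (Section.postcomp (f := f) e he) := by
  rintro ⟨y, σ, hσ⟩ ⟨y', τ, hτ⟩ h
  simp only [Section.postcomp, Section.mk.injEq] at h
  obtain ⟨rfl, h⟩ := h
  refine Section.ext' rfl fun x h1 h2 => hi ?_
  exact congrFun (congrFun (eq_of_heq h) x) h1

/-- A section of `B` lifts along an injective map `A → B` over `X` if its values do. -/
theorem Section.exists_postcomp {f : X →[G] Y} {A B : GSetOver G X}
    (e : A.carrier → B.carrier) (he : ∀ a, B.map (e a) = A.map a) (s : Section f B)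
    (hs : ∀ x hx, ∃ a, e a = s.toFun x hx) : ∃ t : Section f A, t.postcomp e he = s := by
  choose τ hτ using hs
  refine ⟨⟨s.pt, τ, fun x hx => ?_⟩, Section.ext' rfl fun x h1 h2 => hτ x h1⟩
  rw [← he, hτ, s.map_toFun]

theorem Iso.sections [Finite X] [Finite Y] (f : X →[G] Y) {A A' : GSetOver G X} (h : Iso A A') :
    Iso (A.sections f) (A'.sections f) := by
  obtain ⟨e, h1, h2⟩ := h
  refine Iso.of_bijective (Section.postcomp e h2)
    ⟨Section.postcomp_injective e h2 e.injective, fun s => ?_⟩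
    (Section.postcomp_smul e h2 h1) (fun _ => rfl)
  exact Section.exists_postcomp e h2 s fun x hx => e.surjective _

end GSetOver

/-- The semiring of isomorphism classes of finite `G`-sets over `X`. -/
def BurnsideSemiring (G : Type u) [Group G] (X : Type u) [MulAction G X] : Type (u + 1) :=
  Quotient (GSetOver.setoid G X)

namespace BurnsideSemiring

open GSetOver

variable {G : Type u} [Group G] {X Y : Type u} [MulAction G X] [MulAction G Y]

/-- The isomorphism class of a finite `G`-set over `X`. -/
def mk (A : GSetOver G X) : BurnsideSemiring G X := Quotient.mk _ A

theorem sound {A B : GSetOver G X} (h : Iso A B) : mk A = mk B := Quotient.sound h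

theorem mk_eq {A B : GSetOver G X} : mk A = mk B ↔ Iso A B := Quotient.eq

instance : Zero (BurnsideSemiring G X) := ⟨mk empty⟩

instance : Add (BurnsideSemiring G X) :=
  ⟨Quotient.map₂ GSetOver.sum fun _ _ h _ _ h' => h.sum h'⟩

instance : Mul (BurnsideSemiring G X) :=
  ⟨Quotient.map₂ GSetOver.prod fun _ _ h _ _ h' => h.prod h'⟩

instance [Finite X] : One (BurnsideSemiring G X) := ⟨mk terminal⟩

theorem mk_sum (A B : GSetOver G X) : mk (A.sum B) = mk A + mk B := rfl
theorem mk_prod (A B : GSetOver G X) : mk (A.prod B) = mk A * mk B := rfl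

protected theorem add_comm (a b : BurnsideSemiring G X) : a + b = b + a := by
  induction a using Quotient.inductionOn with | _ A
  induction b using Quotient.inductionOn with | _ B
  refine sound ⟨Equiv.sumComm _ _, ?_, ?_⟩
  · rintro g (a | a) <;> rfl
  · rintro (a | a) <;> rfl

protected theorem zero_add (a : BurnsideSemiring G X) : 0 + a = a := by
  induction a using Quotient.inductionOn with | _ A
  refine sound ⟨(Equiv.emptySum PEmpty _), ?_, ?_⟩
  · rintro g (a | a)
    · exact a.elim
    · rfl
  · rintro (a | a)
    · exact a.elim
    · rfl

protected theorem mul_comm (a b : BurnsideSemiring G X) : a * b = b * a := by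
  induction a using Quotient.inductionOn with | _ A
  induction b using Quotient.inductionOn with | _ B
  refine sound ⟨⟨fun z => ⟨(z.1.2, z.1.1), z.2.symm⟩, fun z => ⟨(z.1.2, z.1.1), z.2.symm⟩,
    fun _ => rfl, fun _ => rfl⟩, fun _ _ => rfl, fun z => z.2.symm⟩

protected theorem right_distrib (a b c : BurnsideSemiring G X) : (a + b) * c = a * c + b * c := by
  induction a using Quotient.inductionOn with | _ A
  induction b using Quotient.inductionOn with | _ B
  induction c using Quotient.inductionOn with | _ C
  refine sound (Iso.symm ⟨⟨Sum.elim
      (fun z => ⟨(Sum.inl z.1.1, z.1.2), z.2⟩) (fun z => ⟨(Sum.inr z.1.1, z.1.2), z.2⟩),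
    fun z => match z with
      | ⟨(Sum.inl a, c), h⟩ => Sum.inl ⟨(a, c), h⟩
      | ⟨(Sum.inr b, c), h⟩ => Sum.inr ⟨(b, c), h⟩, ?_, ?_⟩, ?_, ?_⟩)
  · rintro (z | z) <;> rfl
  · rintro ⟨⟨a | b, c⟩, h⟩ <;> rfl
  · rintro g (z | z) <;> rfl
  · rintro (z | z) <;> rfl

protected theorem one_mul [Finite X] (a : BurnsideSemiring G X) : 1 * a = a := by
  induction a using Quotient.inductionOn with | _ A
  refine sound (Iso.of_bijective (fun z => z.1.2) ⟨?_, ?_⟩ ?_ ?_)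
  · rintro ⟨⟨x, a⟩, h⟩ ⟨⟨x', a'⟩, h'⟩ hh
    obtain rfl : a = a' := hh
    exact Subtype.ext (Prod.ext (h.trans h'.symm) rfl)
  · exact fun a => ⟨⟨(A.map a, a), rfl⟩, rfl⟩
  · exact fun _ _ => rfl
  · exact fun z => z.2.symm

instance [Finite X] : CommSemiring (BurnsideSemiring G X) where
  add_assoc a b c := by
    induction a using Quotient.inductionOn with | _ A
    induction b using Quotient.inductionOn with | _ B
    induction c using Quotient.inductionOn with | _ C
    refine sound ⟨Equiv.sumAssoc _ _ _, ?_, ?_⟩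
    · rintro g ((a | a) | a) <;> rfl
    · rintro ((a | a) | a) <;> rfl
  zero_add := BurnsideSemiring.zero_add
  add_zero a := by rw [BurnsideSemiring.add_comm, BurnsideSemiring.zero_add]
  add_comm := BurnsideSemiring.add_comm
  nsmul := nsmulRec
  mul_assoc a b c := by
    induction a using Quotient.inductionOn with | _ A
    induction b using Quotient.inductionOn with | _ B
    induction c using Quotient.inductionOn with | _ C
    exact sound ⟨⟨fun z => ⟨(z.1.1.1.1, ⟨(z.1.1.1.2, z.1.2), z.1.1.2.symm.trans z.2⟩), z.1.1.2⟩,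
      fun z => ⟨(⟨(z.1.1, z.1.2.1.1), z.2⟩, z.1.2.1.2), z.2.trans z.1.2.2⟩,
      fun _ => rfl, fun _ => rfl⟩, fun _ _ => rfl, fun _ => rfl⟩
  mul_comm := BurnsideSemiring.mul_comm
  one_mul := BurnsideSemiring.one_mul
  mul_one a := by rw [BurnsideSemiring.mul_comm, BurnsideSemiring.one_mul]
  right_distrib := BurnsideSemiring.right_distrib
  left_distrib a b c := by
    rw [BurnsideSemiring.mul_comm, BurnsideSemiring.right_distrib, BurnsideSemiring.mul_comm b,
      BurnsideSemiring.mul_comm c]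
  zero_mul a := by
    induction a using Quotient.inductionOn with | _ A
    refine sound (Iso.of_bijective (fun z => z.1.1) ⟨?_, ?_⟩ ?_ ?_)
    · exact fun z => z.1.1.elim
    · exact fun z => z.elim
    · exact fun _ z => z.1.1.elim
    · exact fun z => z.1.1.elim
  mul_zero a := by
    rw [BurnsideSemiring.mul_comm]
    induction a using Quotient.inductionOn with | _ A
    refine sound (Iso.of_bijective (fun z => z.1.1) ⟨?_, ?_⟩ ?_ ?_)
    · exact fun z => z.1.1.elim
    · exact fun z => z.elim
    · exact fun _ z => z.1.1.elim
    · exact fun z => z.1.1.elim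

variable [Finite X] [Finite Y]

/-- Restriction along `f`, by fibre products. -/
def res (f : X →[G] Y) : BurnsideSemiring G Y →+* BurnsideSemiring G X where
  toFun := Quotient.map (GSetOver.pullback f) fun _ _ h => h.pullback f
  map_zero' := by
    refine sound (Iso.of_bijective (fun z => z.1.2) ⟨?_, ?_⟩ ?_ ?_)
    · exact fun z => z.1.2.elim
    · exact fun z => z.elim
    · exact fun _ z => z.1.2.elim
    · exact fun z => z.1.2.elim
  map_one' := by
    refine sound (Iso.of_bijective (fun z => z.1.1) ⟨?_, ?_⟩ ?_ ?_)
    · rintro ⟨⟨x, a⟩, h⟩ ⟨⟨x', a'⟩, h'⟩ hh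
      obtain rfl : x = x' := hh
      exact Subtype.ext (Prod.ext rfl (h.symm.trans h'))
    · exact fun x => ⟨⟨(x, f x), rfl⟩, rfl⟩
    · exact fun _ _ => rfl
    · exact fun z => rfl
  map_add' a b := by
    induction a using Quotient.inductionOn with | _ A
    induction b using Quotient.inductionOn with | _ B
    refine sound (Iso.symm ⟨⟨Sum.elim
        (fun z => ⟨(z.1.1, Sum.inl z.1.2), z.2⟩) (fun z => ⟨(z.1.1, Sum.inr z.1.2), z.2⟩),
      fun z => match z with
        | ⟨(x, Sum.inl a), h⟩ => Sum.inl ⟨(x, a), h⟩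
        | ⟨(x, Sum.inr b), h⟩ => Sum.inr ⟨(x, b), h⟩, ?_, ?_⟩, ?_, ?_⟩)
    · rintro (z | z) <;> rfl
    · rintro ⟨⟨x, a | b⟩, h⟩ <;> rfl
    · rintro g (z | z) <;> rfl
    · rintro (z | z) <;> rfl
  map_mul' a b := by
    induction a using Quotient.inductionOn with | _ A
    induction b using Quotient.inductionOn with | _ B
    refine sound ⟨⟨fun z => ⟨(⟨(z.1.1, z.1.2.1.1), z.2⟩,
        ⟨(z.1.1, z.1.2.1.2), z.2.trans z.1.2.2⟩), rfl⟩,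
      fun z => ⟨(z.1.1.1.1, ⟨(z.1.1.1.2, z.1.2.1.2),
        z.1.1.2.symm.trans ((congrArg f z.2).trans z.1.2.2)⟩), z.1.1.2⟩, fun _ => rfl, fun z => ?_⟩,
      fun _ _ => rfl, fun _ => rfl⟩
    exact Subtype.ext (Prod.ext rfl (Subtype.ext (Prod.ext z.2 rfl)))

/-- Additive transfer along `f`, by composition. -/
def ind (f : X →[G] Y) : BurnsideSemiring G X →+ BurnsideSemiring G Y where
  toFun := Quotient.map (GSetOver.pushforward f) fun _ _ h => h.pushforward f
  map_zero' := sound ⟨Equiv.refl _, fun _ _ => rfl, fun a => a.elim⟩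
  map_add' a b := by
    induction a using Quotient.inductionOn with | _ A
    induction b using Quotient.inductionOn with | _ B
    refine sound ⟨Equiv.refl _, fun _ _ => rfl, ?_⟩
    rintro (a | a) <;> rfl

/-- Multiplicative transfer along `f`, by `A ↦ Π_f(A)`. -/
def jnd (f : X →[G] Y) : BurnsideSemiring G X → BurnsideSemiring G Y :=
  Quotient.map (GSetOver.sections f) fun _ _ h => h.sections f

end BurnsideSemiring

/-! ### Grothendieck rings and polynomial maps -/


noncomputable section

/-- The Grothendieck ring of a commutative semiring: formal differences. -/
def GrothendieckRing (S : Type*) [CommSemiring S] : Type _ := Algebra.GrothendieckAddGroup S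

namespace GrothendieckRing

variable {S T : Type*} [CommSemiring S] [CommSemiring T]

instance : AddCommGroup (GrothendieckRing S) :=
  inferInstanceAs (AddCommGroup (Algebra.GrothendieckAddGroup S))

/-- The canonical map from a semiring to its Grothendieck ring. -/
def of : S →+ GrothendieckRing S := Algebra.GrothendieckAddGroup.of

/-- The universal property of the underlying additive group. -/
def lift {N : Type*} [AddCommGroup N] (f : S →+ N) : GrothendieckRing S →+ N :=
  Algebra.GrothendieckAddGroup.lift f

@[simp]
theorem lift_of {N : Type*} [AddCommGroup N] (f : S →+ N) (s : S) : lift f (of s) = f s :=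
  DFunLike.congr_fun (Algebra.GrothendieckAddGroup.lift.symm_apply_apply f) s

theorem hom_ext {N : Type*} [AddCommGroup N] {f g : GrothendieckRing S →+ N}
    (h : ∀ s, f (of s) = g (of s)) : f = g :=
  Algebra.GrothendieckAddGroup.lift.symm.injective (AddMonoidHom.ext h)

theorem exists_eq_sub (x : GrothendieckRing S) : ∃ a b : S, x = of a - of b := by
  obtain ⟨y, hy⟩ := (AddLocalization.addMonoidOf (⊤ : AddSubmonoid S)).surj x
  exact ⟨y.1, y.2, eq_sub_of_add_eq hy⟩

/-- The multiplication as a biadditive map. -/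
def mulHom : GrothendieckRing S →+ GrothendieckRing S →+ GrothendieckRing S :=
  lift (AddMonoidHom.flip (lift (AddMonoidHom.flip
    ((AddMonoidHom.mul (R := S)).compr₂ (of (S := S))))))

instance : Mul (GrothendieckRing S) := ⟨fun x y => mulHom x y⟩

theorem of_mul (a b : S) : (of (a * b) : GrothendieckRing S) = of a * of b := by
  change _ = mulHom _ _
  simp [mulHom]

theorem mul_def' (x y : GrothendieckRing S) : x * y = mulHom x y := rfl

instance : CommRing (GrothendieckRing S) where
  __ := (inferInstance : AddCommGroup (GrothendieckRing S))
  one := of 1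
  left_distrib x y z := map_add (mulHom x) y z
  right_distrib x y z := by simp [mul_def']
  zero_mul x := by simp [mul_def']
  mul_zero x := by simp [mul_def']
  mul_comm x y := by
    obtain ⟨a, b, rfl⟩ := exists_eq_sub x
    obtain ⟨c, d, rfl⟩ := exists_eq_sub y
    simp only [mul_def', map_sub, AddMonoidHom.sub_apply]
    simp only [← mul_def', ← of_mul, mul_comm c, mul_comm d]
    abel
  mul_assoc x y z := by
    obtain ⟨a, b, rfl⟩ := exists_eq_sub x
    obtain ⟨c, d, rfl⟩ := exists_eq_sub y
    obtain ⟨e, f, rfl⟩ := exists_eq_sub z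
    simp only [mul_def', map_sub, AddMonoidHom.sub_apply]
    simp only [← mul_def', ← of_mul, mul_assoc]
  one_mul x := by
    obtain ⟨a, b, rfl⟩ := exists_eq_sub x
    change mulHom (of 1) _ = _
    simp only [map_sub]
    simp only [← mul_def', ← of_mul, one_mul]
  mul_one x := by
    obtain ⟨a, b, rfl⟩ := exists_eq_sub x
    change mulHom _ (of 1) = _
    simp only [map_sub, AddMonoidHom.sub_apply]
    simp only [← mul_def', ← of_mul, mul_one]

theorem of_one : (of 1 : GrothendieckRing S) = 1 := rfl

/-- Functoriality for semiring homomorphisms. -/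
def mapRingHom (f : S →+* T) : GrothendieckRing S →+* GrothendieckRing T where
  __ := lift (of.comp f.toAddMonoidHom)
  map_one' := by
    change lift _ (of 1) = _
    rw [lift_of]
    simp [of_one]
  map_mul' x y := by
    obtain ⟨a, b, rfl⟩ := exists_eq_sub x
    obtain ⟨c, d, rfl⟩ := exists_eq_sub y
    change lift _ _ = lift _ _ * lift _ _
    simp only [mul_sub, sub_mul, ← of_mul, map_sub, lift_of]
    simp [of_mul]

end GrothendieckRing

/-- A map from a commutative monoid to an abelian group is polynomial if its iterated differences
of some order vanish. -/
def IsPolynomialMap {M N : Type*} [AddCommMonoid M] [AddCommGroup N] (f : M → N) : Prop :=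
  ∃ n : ℕ, ∀ b a : M, (fwdDiff b)^[n] f a = 0

namespace IsPolynomialMap

variable {S : Type*} [CommSemiring S] {N : Type*} [AddCommGroup N]

open GrothendieckRing

theorem iterate_zero {M : Type*} [AddCommMonoid M] (b : M) (n : ℕ) :
    (fwdDiff b)^[n] (0 : M → N) = 0 := by
  rw [← fwdDiff_aux.coe_fwdDiffₗ_pow, map_zero]

theorem sub {M : Type*} [AddCommMonoid M] {g h : M → N} (hg : IsPolynomialMap g)
    (hh : IsPolynomialMap h) : IsPolynomialMap (g - h) := by
  obtain ⟨m, hm⟩ := hg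
  obtain ⟨n, hn⟩ := hh
  refine ⟨m + n, fun b => congrFun ?_⟩
  have h1 : (fwdDiff b)^[m] g = 0 := funext (hm b)
  have h2 : (fwdDiff b)^[n] h = 0 := funext (hn b)
  rw [← fwdDiff_aux.coe_fwdDiffₗ_pow, map_sub, fwdDiff_aux.coe_fwdDiffₗ_pow]
  nth_rw 1 [add_comm]
  rw [Function.iterate_add_apply, h1, Function.iterate_add_apply, h2, iterate_zero, iterate_zero,
    sub_zero]
  rfl

/-- A polynomial map on a Grothendieck ring is determined by its values on the semiring. -/
theorem ext {g h : GrothendieckRing S → N} (hg : IsPolynomialMap g) (hh : IsPolynomialMap h)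
    (hgh : ∀ s, g (of s) = h (of s)) : g = h := by
  obtain ⟨n, hn⟩ := hg.sub hh
  funext x
  obtain ⟨a, b, rfl⟩ := exists_eq_sub x
  have key := hn (of b) (of a - of b)
  rw [fwdDiff_iter_eq_sum_shift, Finset.sum_range_succ', Finset.sum_eq_zero] at key
  · have : (-1 : ℤ) ^ n • (g (of a - of b) - h (of a - of b)) = 0 := by simpa using key
    rw [← sub_eq_zero]
    rcases neg_one_pow_eq_or ℤ n with hs | hs
    · rwa [hs, one_smul] at this
    · rwa [hs, neg_smul, one_smul, neg_eq_zero] at this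
  · intro k _
    have : of a - of b + (k + 1) • of b = of (a + k • b) := by
      rw [map_add, map_nsmul, succ_nsmul]; abel
    rw [this, Pi.sub_apply, hgh, sub_self, smul_zero]

theorem fwdDiff_iter_eq {M R : Type*} [AddCommMonoid M] [CommRing R] (F : R →+ N) (e : M → R)
    (he : ∀ a b, e (a + b) = e a * e b) (b : M) (n : ℕ) (a : M) :
    (fwdDiff b)^[n] (fun a => F (e a)) a = F (e a * (e b - 1) ^ n) := by
  induction n generalizing a with
  | zero => simp
  | succ n ih =>
    rw [Function.iterate_succ_apply', fwdDiff, ih, ih, he, ← map_sub]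
    congr 1
    ring

/-- A polynomial map on a semiring extends to its Grothendieck ring. -/
theorem exists_extension {f : S → N} (hf : IsPolynomialMap f) :
    ∃ g : GrothendieckRing S → N, IsPolynomialMap g ∧ ∀ s, g (of s) = f s := by
  obtain ⟨n, hn⟩ := hf
  let F : AddMonoidAlgebra ℤ S →+ N :=
    (Finsupp.liftAddHom fun s => zmultiplesHom N (f s)).comp
      AddMonoidAlgebra.coeffAddEquiv.toAddMonoidHom
  let e : S → AddMonoidAlgebra ℤ S := fun s => AddMonoidAlgebra.single s 1
  have he : ∀ a b, e (a + b) = e a * e b := fun a b => by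
    simp [e, AddMonoidAlgebra.single_mul_single]
  have hF : ∀ s, F (e s) = f s := fun s => by simp [F, e]
  let J : Ideal (AddMonoidAlgebra ℤ S) :=
    { carrier := {x | ∀ y, F (y * x) = 0}
      add_mem' := fun {x x'} hx hx' y => by rw [mul_add, map_add, hx, hx', add_zero]
      zero_mem' := fun y => by simp
      smul_mem' := fun c x hx y => by rw [smul_eq_mul, ← mul_assoc, hx] }
  have hJ : ∀ b, (e b - 1) ^ n ∈ J := fun b y => by
    have key : (fun y => F (y * (e b - 1) ^ n)) = 0 := by
      funext y
      induction y using AddMonoidAlgebra.induction_linear with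
      | zero => simp
      | add x y hx hy =>
        simp only [Pi.zero_apply] at hx hy ⊢
        rw [add_mul, map_add, hx, hy, add_zero]
      | single m r =>
        have h1 : AddMonoidAlgebra.single m r = r • e m := by simp [e]
        have h2 := fwdDiff_iter_eq F e he b n m
        simp only [hF] at h2
        simp only [Pi.zero_apply, h1, smul_mul_assoc, map_zsmul, ← h2]
        rw [hn, smul_zero]
    exact congrFun key y
  let π := Ideal.Quotient.mk J
  have hnil : ∀ b, (π (e b) - 1) ^ n = 0 := fun b => by
    rw [← map_one π, ← map_sub, ← map_pow]
    exact Ideal.Quotient.eq_zero_iff_mem.2 (hJ b)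
  have hunit : ∀ b, IsUnit (π (e b)) := fun b => by
    have : IsNilpotent (π (e b) - 1) := ⟨n, hnil b⟩
    simpa using this.isUnit_add_one
  let u : S →+ Additive (AddMonoidAlgebra ℤ S ⧸ J)ˣ :=
    { toFun := fun b => Additive.ofMul (hunit b).unit
      map_zero' := by
        apply Additive.toMul.injective
        ext
        simp [e, ← AddMonoidAlgebra.one_def]
      map_add' := fun a b => by
        apply Additive.toMul.injective
        ext
        simp [he] }
  let v : GrothendieckRing S → AddMonoidAlgebra ℤ S ⧸ J := fun x =>
    ((Additive.toMul (lift u x) : (AddMonoidAlgebra ℤ S ⧸ J)ˣ) : AddMonoidAlgebra ℤ S ⧸ J)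
  have hv : ∀ x y, v (x + y) = v x * v y := fun x y => by simp [v]
  have hv_of : ∀ s, v (of s) = π (e s) := fun s => by simp [v, u]
  let F' : AddMonoidAlgebra ℤ S ⧸ J →+ N :=
    QuotientAddGroup.lift J.toAddSubgroup F fun x hx => by
      have : F (1 * x) = 0 := hx 1
      simpa using this
  refine ⟨fun x => F' (v x), ⟨n + n, fun b a => ?_⟩, fun s => ?_⟩
  · rw [fwdDiff_iter_eq F' v hv]
    obtain ⟨c, d, rfl⟩ := exists_eq_sub b
    have h1 : v (of c - of d) * v (of d) = v (of c) := by rw [← hv, sub_add_cancel]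
    have h2 : (v (of c - of d) - 1) ^ (n + n) * v (of d) ^ (n + n) = 0 := by
      rw [← mul_pow, sub_mul, h1, one_mul, hv_of, hv_of,
        show π (e c) - π (e d) = (π (e c) - 1) + -(π (e d) - 1) by ring]
      refine (Commute.all _ _).add_pow_eq_zero_of_add_le_succ_of_pow_eq_zero (hnil c)
        (n := n) ?_ (by omega)
      exact (neg_pow _ _).trans (by rw [hnil d, mul_zero])
    have h3 : IsUnit (v (of d) ^ (n + n)) := (by rw [hv_of]; exact hunit d : IsUnit _).pow _
    rw [h3.mul_left_eq_zero.1 h2, mul_zero, map_zero]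
  · change F' (v (of s)) = f s
    rw [hv_of, ← hF]
    rfl

/-- The unique polynomial extension of a polynomial map to the Grothendieck ring. -/
theorem existsUnique_extension {f : S → N} (hf : IsPolynomialMap f) :
    ∃! g : GrothendieckRing S → N, IsPolynomialMap g ∧ ∀ s, g (of s) = f s := by
  obtain ⟨g, hg, hgf⟩ := hf.exists_extension
  exact ⟨g, ⟨hg, hgf⟩, fun h hh => hh.1.ext hg fun s => by rw [hgf, hh.2]⟩

end IsPolynomialMap

namespace GSetOver

open GrothendieckRing

variable {G : Type u} [Group G] {X Y : Type u} [MulAction G X] [MulAction G Y]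

/-- The disjoint union of `n` copies of `B`. -/
def copies (B : GSetOver G X) (n : ℕ) : GSetOver G X :=
  letI : MulAction G (B.carrier × Fin n) :=
    { smul := fun g z => (g • z.1, z.2)
      one_smul := fun z => Prod.ext (one_smul G z.1) rfl
      mul_smul := fun g h z => Prod.ext (mul_smul g h z.1) rfl }
  { carrier := B.carrier × Fin n
    map := { toFun := fun z => B.map z.1, map_smul' := fun g z => map_smul B.map g z.1 } }

/-- A section of `A ⊔ B ⊔ ⋯ ⊔ B` meets every copy of `B`. -/
def Section.Hits {f : X →[G] Y} {A B : GSetOver G X} {n : ℕ}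
    (s : Section f (A.sum (B.copies n))) : Prop :=
  ∀ i, ∃ x hx b, s.toFun x hx = Sum.inr (b, i)

theorem Section.Hits.smul {f : X →[G] Y} {A B : GSetOver G X} {n : ℕ}
    {s : Section f (A.sum (B.copies n))} (hs : s.Hits) (g : G) : (g • s).Hits := fun i => by
  obtain ⟨x, hx, b, h⟩ := hs i
  refine ⟨g • x, by rw [map_smul, hx, Section.smul_pt], g • b, ?_⟩
  rw [Section.smul_toFun, s.toFun_congr (inv_smul_smul g x) _ hx, h]
  rfl

variable [Finite X]

/-- The sections of `A ⊔ B ⊔ ⋯ ⊔ B` that meet every copy of `B`. -/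
def hitting [Finite Y] (f : X →[G] Y) (A B : GSetOver G X) (n : ℕ) : GSetOver G Y where
  carrier := ({ carrier := {s | s.Hits}, smul_mem' := fun g _ hs => hs.smul g } :
    SubMulAction G (Section f (A.sum (B.copies n))))
  finite := Subtype.finite
  map := { toFun := fun s => s.1.pt, map_smul' := fun _ _ => rfl }

theorem hitting_zero [Finite Y] (f : X →[G] Y) (A B : GSetOver G X) :
    Iso (hitting f A B 0) (A.sections f) := by
  let e : A.carrier → (A.sum (B.copies 0)).carrier := Sum.inl
  refine Iso.symm (Iso.of_bijective
    (fun s => ⟨Section.postcomp e (fun _ => rfl) s, fun i => i.elim0⟩) ⟨?_, ?_⟩ ?_ ?_)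
  · intro s t h
    exact Section.postcomp_injective e (fun _ => rfl) Sum.inl_injective (congrArg Subtype.val h)
  · rintro ⟨s, hs⟩
    obtain ⟨t, ht⟩ := Section.exists_postcomp e (fun _ => rfl) s fun x hx => by
      rcases s.toFun x hx with a | ⟨_, i⟩
      · exact ⟨a, rfl⟩
      · exact i.elim0
    exact ⟨t, Subtype.ext ht⟩
  · exact fun g s => Subtype.ext (Section.postcomp_smul e (fun _ => rfl) (fun _ _ => rfl) g s)
  · exact fun _ => rfl

theorem hitting_succ [Finite Y] (f : X →[G] Y) (A B : GSetOver G X) (n : ℕ) :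
    Iso (hitting f (A.sum B) B n) ((hitting f A B n).sum (hitting f A B (n + 1))) := by
  let e₀ : (A.sum (B.copies n)).carrier → ((A.sum B).sum (B.copies n)).carrier :=
    Sum.elim (fun a => Sum.inl (Sum.inl a)) Sum.inr
  let e₁ : (A.sum (B.copies (n + 1))).carrier → ((A.sum B).sum (B.copies n)).carrier :=
    Sum.elim (fun a => Sum.inl (Sum.inl a)) fun z =>
      Fin.cases (Sum.inl (Sum.inr z.1)) (fun i => Sum.inr (z.1, i)) z.2
  have he₀ : ∀ z, ((A.sum B).sum (B.copies n)).map (e₀ z) = (A.sum (B.copies n)).map z := by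
    rintro (a | z) <;> rfl
  have he₁ : ∀ z, ((A.sum B).sum (B.copies n)).map (e₁ z) =
      (A.sum (B.copies (n + 1))).map z := by
    rintro (a | ⟨b, i⟩)
    · rfl
    · cases i using Fin.cases <;> rfl
  have hi₀ : Function.Injective e₀ := by
    rintro (a | z) (a' | z') h
    · cases h; rfl
    · cases h
    · cases h
    · cases h; rfl
  have hi₁ : Function.Injective e₁ := by
    rintro (a | ⟨b, i⟩) (a' | ⟨b', i'⟩) h
    · cases h; rfl
    · cases i' using Fin.cases <;> cases h
    · cases i using Fin.cases <;> cases h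
    · cases i using Fin.cases with
      | zero => cases i' using Fin.cases <;> cases h; rfl
      | succ i =>
        cases i' using Fin.cases with
        | zero => cases h
        | succ i' =>
          have h' : (b, i) = (b', i') := Sum.inr.inj h
          cases h'
          rfl
  have hs₁ : Function.Surjective e₁ := by
    rintro ((a | b) | ⟨b, i⟩)
    · exact ⟨Sum.inl a, rfl⟩
    · exact ⟨Sum.inr (b, 0), rfl⟩
    · exact ⟨Sum.inr (b, i.succ), rfl⟩
  have hg₀ : ∀ (g : G) z, e₀ (g • z) = g • e₀ z := by
    rintro g (a | z) <;> rfl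
  have hg₁ : ∀ (g : G) z, e₁ (g • z) = g • e₁ z := by
    rintro g (a | ⟨b, i⟩)
    · rfl
    · cases i using Fin.cases <;> rfl
  have hh₀ : ∀ s : Section f (A.sum (B.copies n)), s.Hits → (s.postcomp e₀ he₀).Hits := by
    intro s hs i
    obtain ⟨x, hx, b, h⟩ := hs i
    exact ⟨x, hx, b, congrArg e₀ h⟩
  have hh₁ : ∀ s : Section f (A.sum (B.copies (n + 1))), s.Hits → (s.postcomp e₁ he₁).Hits := by
    intro s hs i
    obtain ⟨x, hx, b, h⟩ := hs i.succ
    exact ⟨x, hx, b, congrArg e₁ h⟩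
  have hdisj : ∀ (s : Section f (A.sum (B.copies n))) (t : Section f (A.sum (B.copies (n + 1)))),
      t.Hits → s.postcomp e₀ he₀ ≠ t.postcomp e₁ he₁ := by
    rintro ⟨y, σ, hσ⟩ ⟨y', τ, hτ⟩ ht h
    simp only [Section.postcomp, Section.mk.injEq] at h
    obtain ⟨rfl, h⟩ := h
    obtain ⟨x, hx, b, hb⟩ := ht 0
    have h' := congrFun (congrFun (eq_of_heq h) x) hx
    change τ x hx = _ at hb
    rw [hb] at h'
    rcases hz : σ x hx with a | z <;> rw [hz] at h' <;> cases h'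
  refine Iso.symm (Iso.of_bijective (Sum.elim
    (fun s => ⟨s.1.postcomp e₀ he₀, hh₀ _ s.2⟩) (fun s => ⟨s.1.postcomp e₁ he₁, hh₁ _ s.2⟩))
    ⟨?_, ?_⟩ ?_ ?_)
  · rintro (⟨s, hs⟩ | ⟨s, hs⟩) (⟨t, ht⟩ | ⟨t, ht⟩) h
    · have h' := congrArg Subtype.val h
      exact congrArg Sum.inl (Subtype.ext (Section.postcomp_injective e₀ he₀ hi₀ h'))
    · exact (hdisj s t ht (congrArg Subtype.val h)).elim
    · exact (hdisj t s hs (congrArg Subtype.val h).symm).elim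
    · have h' := congrArg Subtype.val h
      exact congrArg Sum.inr (Subtype.ext (Section.postcomp_injective e₁ he₁ hi₁ h'))
  · rintro ⟨s, hs⟩
    by_cases hB : ∃ x hx b, s.toFun x hx = Sum.inl (Sum.inr b)
    · obtain ⟨t, rfl⟩ := Section.exists_postcomp e₁ he₁ s fun x hx => hs₁ _
      refine ⟨Sum.inr ⟨t, fun i => ?_⟩, rfl⟩
      cases i using Fin.cases with
      | zero =>
        obtain ⟨x, hx, b, h⟩ := hB
        exact ⟨x, hx, b, hi₁ h⟩
      | succ i =>
        obtain ⟨x, hx, b, h⟩ := hs i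
        exact ⟨x, hx, b, hi₁ h⟩
    · obtain ⟨t, rfl⟩ := Section.exists_postcomp e₀ he₀ s fun x hx => by
        rcases hz : s.toFun x hx with (a | b) | z
        · exact ⟨Sum.inl a, rfl⟩
        · exact (hB ⟨x, hx, b, hz⟩).elim
        · exact ⟨Sum.inr z, rfl⟩
      refine ⟨Sum.inl ⟨t, fun i => ?_⟩, rfl⟩
      obtain ⟨x, hx, b, h⟩ := hs i
      exact ⟨x, hx, b, hi₀ h⟩
  · rintro g (s | s)
    · exact Subtype.ext (Section.postcomp_smul e₀ he₀ hg₀ g s.1)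
    · exact Subtype.ext (Section.postcomp_smul e₁ he₁ hg₁ g s.1)
  · rintro (s | s) <;> rfl

/-- A section over a fibre with fewer than `n` points cannot meet `n` disjoint subsets. -/
theorem not_hits {f : X →[G] Y} {A B : GSetOver G X} {n : ℕ} (hn : Nat.card X < n)
    (s : Section f (A.sum (B.copies n))) : ¬ s.Hits := by
  intro hs
  choose x hx b h using hs
  refine absurd (Nat.card_le_card_of_injective x fun i j hij => ?_) (by simpa using hn)
  have h1 := h i
  rw [s.toFun_congr hij (hx i) (hx j), h j] at h1
  exact (Prod.mk.inj (Sum.inr.inj h1)).2.symm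

end GSetOver

namespace BurnsideSemiring

open GSetOver GrothendieckRing

variable {G : Type u} [Group G] {X Y : Type u} [MulAction G X] [MulAction G Y] [Finite X]
  [Finite Y]

theorem jnd_mk (f : X →[G] Y) (A : GSetOver G X) : jnd f (mk A) = mk (A.sections f) := rfl

theorem fwdDiff_jnd (f : X →[G] Y) (A B : GSetOver G X) (n : ℕ) :
    (fwdDiff (mk B))^[n] (fun a => of (jnd f a)) (mk A) = of (mk (hitting f A B n)) := by
  induction n generalizing A with
  | zero => exact congrArg of (sound (hitting_zero f A B).symm)
  | succ n ih =>
    rw [Function.iterate_succ_apply', fwdDiff, ← mk_sum, ih, ih, sound (hitting_succ f A B n),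
      mk_sum, map_add, add_sub_cancel_left]

theorem isPolynomialMap_jnd (f : X →[G] Y) :
    IsPolynomialMap fun a : BurnsideSemiring G X => of (jnd f a) := by
  refine ⟨Nat.card X + 1, fun b a => ?_⟩
  induction a using Quotient.inductionOn with | _ A
  induction b using Quotient.inductionOn with | _ B
  refine (fwdDiff_jnd f A B _).trans ?_
  have : mk (hitting f A B (Nat.card X + 1)) = 0 := by
    have hE : IsEmpty (hitting f A B (Nat.card X + 1)).carrier :=
      ⟨fun s => not_hits (Nat.lt_succ_self _) s.1 s.2⟩
    exact sound ⟨Equiv.equivOfIsEmpty _ PEmpty, fun _ s => hE.elim s, fun s => hE.elim s⟩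
  rw [this, map_zero]

end BurnsideSemiring

/-- The Burnside ring `Ω_G(X)`: the Grothendieck ring of the category of finite `G`-sets
over `X`. -/
abbrev BurnsideRing (G : Type u) [Group G] (X : Type u) [MulAction G X] [Finite X] : Type (u + 1) :=
  GrothendieckRing (BurnsideSemiring G X)

namespace BurnsideRing

open GrothendieckRing

variable {G : Type u} [Group G] {X Y : Type u} [MulAction G X] [MulAction G Y] [Finite X]
  [Finite Y]

/-- The class `[A → X]` in `Ω_G(X)`. -/
def cls (A : GSetOver G X) : BurnsideRing G X := of (BurnsideSemiring.mk A)

/-- The restriction `f^*`. -/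
def res (f : X →[G] Y) : BurnsideRing G Y →+* BurnsideRing G X :=
  mapRingHom (BurnsideSemiring.res f)

/-- The additive transfer `f_+`. -/
def ind (f : X →[G] Y) : BurnsideRing G X →+ BurnsideRing G Y :=
  lift (of.comp (BurnsideSemiring.ind f))

/-- The multiplicative transfer `f_•`: the unique polynomial map `Ω_G(X) → Ω_G(Y)` with
`f_• [A → X] = [Π_f(A) → Y]` for every finite `G`-set `A` over `X`. -/
def jnd (f : X →[G] Y) : BurnsideRing G X → BurnsideRing G Y :=
  (BurnsideSemiring.isPolynomialMap_jnd f).existsUnique_extension.choose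

theorem isPolynomialMap_jnd (f : X →[G] Y) : IsPolynomialMap (jnd f) :=
  (BurnsideSemiring.isPolynomialMap_jnd f).existsUnique_extension.choose_spec.1.1

theorem res_cls (f : X →[G] Y) (A : GSetOver G Y) : res f (cls A) = cls (A.pullback f) :=
  lift_of _ _

theorem ind_cls (f : X →[G] Y) (A : GSetOver G X) : ind f (cls A) = cls (A.pushforward f) :=
  lift_of _ _

theorem jnd_cls (f : X →[G] Y) (A : GSetOver G X) : jnd f (cls A) = cls (A.sections f) :=
  (BurnsideSemiring.isPolynomialMap_jnd f).existsUnique_extension.choose_spec.1.2 _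

end BurnsideRing

/-- A finite `G`-set. -/
structure FinGSet (G : Type u) [Group G] : Type (u + 1) where
  of ::
  carrier : Type u
  [action : MulAction G carrier]
  [finite : Finite carrier]

namespace FinGSet

attribute [instance] FinGSet.action FinGSet.finite

instance (G : Type u) [Group G] : CoeSort (FinGSet G) (Type u) := ⟨FinGSet.carrier⟩

/-- A transitive `G`-set has exactly one orbit. -/
def IsTransitive {G : Type u} [Group G] (X : FinGSet G) : Prop :=
  Nonempty X ∧ MulAction.IsPretransitive G X

end FinGSet

/-- An ideal of the Burnside Tambara functor `Ω_G`. -/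
structure BurnsideIdeal (G : Type u) [Group G] : Type (u + 1) where
  ideal : ∀ X : FinGSet G, Ideal (BurnsideRing G X)
  res_mem : ∀ (X Y : FinGSet G) (f : X →[G] Y), ∀ a ∈ ideal Y, BurnsideRing.res f a ∈ ideal X
  ind_mem : ∀ (X Y : FinGSet G) (f : X →[G] Y), ∀ a ∈ ideal X, BurnsideRing.ind f a ∈ ideal Y
  jnd_mem : ∀ (X Y : FinGSet G) (f : X →[G] Y), ∀ a ∈ ideal X,
    BurnsideRing.jnd f a - BurnsideRing.jnd f 0 ∈ ideal Y

namespace BurnsideIdeal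

variable {G : Type u} [Group G]

theorem ideal_injective : Function.Injective (BurnsideIdeal.ideal (G := G)) := by
  rintro ⟨I, _, _, _⟩ ⟨J, _, _, _⟩ h
  cases h
  rfl

/-- `I ≤ J` means `I(X) ⊆ J(X)` for all `X`. -/
instance : PartialOrder (BurnsideIdeal G) := PartialOrder.lift _ ideal_injective

/-- An ideal `I ⊊ Ω_G` is prime if, for all transitive `X`, `Y` and all `a ∈ Ω_G(X)`,
`b ∈ Ω_G(Y)`, one has `a ∈ I(X)` or `b ∈ I(Y)` exactly when
`(v_• w^* a - v_• 0) * (v'_• w'^* b - v'_• 0) ∈ I(C)` for all diagrams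
`C ← D → X` (maps `v`, `w`) and `C ← D' → Y` (maps `v'`, `w'`) of finite `G`-sets. -/
def IsPrime (I : BurnsideIdeal G) : Prop :=
  (∃ X, I.ideal X ≠ ⊤) ∧
  ∀ X Y : FinGSet G, X.IsTransitive → Y.IsTransitive →
    ∀ (a : BurnsideRing G X) (b : BurnsideRing G Y),
      (∀ (C D D' : FinGSet G) (v : D →[G] C) (w : D →[G] X) (v' : D' →[G] C) (w' : D' →[G] Y),
        (BurnsideRing.jnd v (BurnsideRing.res w a) - BurnsideRing.jnd v 0) *
          (BurnsideRing.jnd v' (BurnsideRing.res w' b) - BurnsideRing.jnd v' 0) ∈ I.ideal C) ↔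
      (a ∈ I.ideal X ∨ b ∈ I.ideal Y)

end BurnsideIdeal

/-- The prime spectrum `Spec Ω_G`, ordered by inclusion. -/
abbrev BurnsideSpec (G : Type u) [Group G] : Type (u + 1) :=
  {I : BurnsideIdeal G // I.IsPrime}

/-- The projection `G/K → G/H` for `K ≤ H`. -/
def quotientProj {G : Type u} [Group G] {K H : Subgroup G} (h : K ≤ H) : G ⧸ K →[G] G ⧸ H where
  toFun := Subgroup.quotientMapOfLE h
  map_smul' := by
    rintro g ⟨x⟩
    rfl

section Cyclic

variable (G : Type u) [CommGroup G]

/-- The subgroup `H_k` of elements `g` with `g ^ (p ^ k) = 1`. In a cyclic group of order `p ^ r`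
with `k ≤ r` it is the subgroup of order `p ^ k`. -/
def subH (p k : ℕ) : Subgroup G := (powMonoidHom (p ^ k) : G →* G).ker

theorem subH_le_succ (p k : ℕ) : subH G p k ≤ subH G p (k + 1) := fun g hg => by
  simp only [subH, MonoidHom.mem_ker, powMonoidHom_apply] at hg ⊢
  rw [pow_succ, pow_mul, hg, one_pow]

variable [Finite G]

/-- The ring `R_k = Ω_G(G/H_k)`. -/
abbrev levelRing (p k : ℕ) : Type (u + 1) := BurnsideRing G (G ⧸ subH G p k)

variable {G} {p k : ℕ}

/-- `L(I) = (res)⁻¹(I)`, the largest extension of `I` to the next level. -/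
def extL (I : Ideal (levelRing G p k)) : Ideal (levelRing G p (k + 1)) :=
  I.comap (BurnsideRing.res (quotientProj (subH_le_succ G p k)))

/-- `S(I) = (ind(I)) + (jnd(I))`, the smallest extension of `I` to the next level. -/
def extS (I : Ideal (levelRing G p k)) : Ideal (levelRing G p (k + 1)) :=
  Ideal.span (BurnsideRing.ind (quotientProj (subH_le_succ G p k)) '' I) ⊔
    Ideal.span (BurnsideRing.jnd (quotientProj (subH_le_succ G p k)) '' I)

/-- The sequence `I₀, S(I₀), …, S^m(I₀), L(S^m(I₀)), L²(S^m(I₀)), …`. -/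
def seqLS (I₀ : Ideal (levelRing G p 0)) (m : ℕ) : ∀ k, Ideal (levelRing G p k)
  | 0 => I₀
  | k + 1 => if k < m then extS (seqLS I₀ m k) else extL (seqLS I₀ m k)

end Cyclic

end

/-! For a point `x` of `X` and a subgroup `K` fixing `x`, counting the `K`-fixed points over `x`
gives a ring homomorphism `mark x K` from the Burnside ring to the integers. Burnside's theorem
(`iso_of_card_fixedFiber`, `ext_mark`) says that these marks separate elements, and restriction and
both transfers have explicit marks; the mark of `f_• a` is a product of marks of `a`, one for each
`K`-orbit in a fibre (`mark_jnd`). Ideals can therefore be studied through marks.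

For a subgroup `H` and a prime `q` of the integers, the elements whose marks at all `K ≤ H` lie in
`q` form a prime ideal `markIdeal H q` (`markIdeal_isPrime`). The work is to show that there are no
others. A prime ideal `I` determines a characteristic `q = I.charIdeal`, the integers in its value
at `G/e`, and `markIdeal ⊤ q ≤ I ≤ markIdeal ⊥ q`. If `p` lies in `q`, the two bounds agree, since
all marks over a point are congruent modulo `p`. Otherwise take the largest `i` with `I ≤ markIdeal
H_i q`; then `I` contains an element with a mark outside `q` at some subgroup of `H_{i+1}`, and
`IsPrime.markIdeal_subH_le` uses it to get the reverse inclusion.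

The device behind all of this is `spread`: an element with mark `β` at `(x, K₀)` is carried to any
`C`, where its marks at all stabilizing `K ≥ K₀` are powers of `β` with exponents bounded
independently of `C`. Vanishing products of the form `u * ∏ (β ^ e - n)` turn this into membership
of `β ^ N * u` (`intCast_pow_mul_mem`), with `N` uniform.

The dimension now follows. The index `i`, plus one if the characteristic is zero, strictly drops
along inclusions (`exists_rank`), so chains have length at most `r + 1`. The chain in the theorem
consists of `markIdeal ⊤ ⊥ = 0` and the ideals `markIdeal H_{r-j} (q)`: up to level `r - j` their
value is `(q)`, which `S` preserves by Fermat's little theorem (`extS_span`), and from there on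
raising the level is the operation `L` (`extL_markIdeal`). -/

namespace GSetOver

/-! ### Fixed points of `G`-sets over `X` -/

variable {G : Type u} [Group G] {X Y : Type u} [MulAction G X] [MulAction G Y]

/-- The points of `A` over `x` that are fixed by `K`. -/
def fixedFiber (A : GSetOver G X) (x : X) (K : Subgroup G) : Set A.carrier :=
  {a | A.map a = x ∧ ∀ g ∈ K, g • a = a}

theorem card_fixedFiber_congr {A B : GSetOver G X} (h : Iso A B) (x : X) (K : Subgroup G) :
    Nat.card (A.fixedFiber x K) = Nat.card (B.fixedFiber x K) := by
  obtain ⟨e, h1, h2⟩ := h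
  refine Nat.card_congr (e.subtypeEquiv fun a => ?_)
  simp only [fixedFiber, Set.mem_ofPred_eq, h2, ← h1, e.apply_eq_iff_eq]

theorem card_fixedFiber_sum (A B : GSetOver G X) (x : X) (K : Subgroup G) :
    Nat.card ((A.sum B).fixedFiber x K) =
      Nat.card (A.fixedFiber x K) + Nat.card (B.fixedFiber x K) := by
  have : (A.sum B).fixedFiber x K ≃ A.fixedFiber x K ⊕ B.fixedFiber x K :=
    { toFun := fun z => match z with
        | ⟨Sum.inl a, h⟩ => Sum.inl ⟨a, h.1, fun g hg => Sum.inl_injective (h.2 g hg)⟩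
        | ⟨Sum.inr a, h⟩ => Sum.inr ⟨a, h.1, fun g hg => Sum.inr_injective (h.2 g hg)⟩
      invFun := Sum.elim
        (fun a => ⟨Sum.inl a.1, a.2.1, fun g hg => congrArg Sum.inl (a.2.2 g hg)⟩)
        (fun a => ⟨Sum.inr a.1, a.2.1, fun g hg => congrArg Sum.inr (a.2.2 g hg)⟩)
      left_inv := by rintro ⟨a | a, h⟩ <;> rfl
      right_inv := by rintro (a | a) <;> rfl }
  rw [Nat.card_congr this, Nat.card_sum]

theorem card_fixedFiber_prod (A B : GSetOver G X) (x : X) (K : Subgroup G) :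
    Nat.card ((A.prod B).fixedFiber x K) =
      Nat.card (A.fixedFiber x K) * Nat.card (B.fixedFiber x K) := by
  rw [← Nat.card_prod]
  refine Nat.card_congr
    { toFun := fun z => (⟨z.1.1.1, z.2.1, fun g hg => ?_⟩,
        ⟨z.1.1.2, z.1.2.symm.trans z.2.1, fun g hg => ?_⟩)
      invFun := fun z => ⟨⟨(z.1.1, z.2.1), z.1.2.1.trans z.2.2.1.symm⟩, z.1.2.1, fun g hg => ?_⟩
      left_inv := fun _ => rfl
      right_inv := fun _ => rfl }
  · exact congrArg (fun w => w.1.1) (z.2.2 g hg)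
  · exact congrArg (fun w => w.1.2) (z.2.2 g hg)
  · exact Subtype.ext (Prod.ext (z.1.2.2 g hg) (z.2.2.2 g hg))

theorem card_fixedFiber_terminal [Finite X] {x : X} {K : Subgroup G}
    (h : K ≤ MulAction.stabilizer G x) :
    Nat.card ((terminal : GSetOver G X).fixedFiber x K) = 1 := by
  have : (terminal : GSetOver G X).fixedFiber x K = {x} := by
    ext a
    refine ⟨fun h => h.1, ?_⟩
    rintro rfl
    exact ⟨rfl, fun g hg => h hg⟩
  rw [this, Nat.card_coe_set_eq]
  exact Set.ncard_singleton x

theorem card_fixedFiber_eq_zero (A : GSetOver G X) {x : X} {K : Subgroup G}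
    (h : ¬ K ≤ MulAction.stabilizer G x) : Nat.card (A.fixedFiber x K) = 0 := by
  have : IsEmpty (A.fixedFiber x K) := ⟨fun a => h fun g hg => by
    rw [MulAction.mem_stabilizer_iff, ← a.2.1, ← map_smul, a.2.2 g hg]⟩
  exact Nat.card_of_isEmpty

theorem card_fixedFiber_pullback [Finite X] (f : X →[G] Y) (A : GSetOver G Y) {x : X}
    {K : Subgroup G} (h : K ≤ MulAction.stabilizer G x) :
    Nat.card ((A.pullback f).fixedFiber x K) = Nat.card (A.fixedFiber (f x) K) := by
  refine Nat.card_congr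
    { toFun := fun z => ⟨z.1.1.2, z.1.2.symm.trans (congrArg f z.2.1), fun g hg => ?_⟩
      invFun := fun z => ⟨⟨(x, z.1), z.2.1.symm⟩, rfl, fun g hg => ?_⟩
      left_inv := fun z => ?_
      right_inv := fun _ => rfl }
  · exact congrArg (fun w => w.1.2) (z.2.2 g hg)
  · exact Subtype.ext (Prod.ext (h hg) (z.2.2 g hg))
  · exact Subtype.ext (Subtype.ext (Prod.ext z.2.1.symm rfl))

theorem card_fixedFiber_pushforward [Finite X] (f : X →[G] Y) (A : GSetOver G X) (y : Y)
    (K : Subgroup G) :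
    Nat.card ((A.pushforward f).fixedFiber y K) =
      ∑ᶠ x : {x // f x = y}, Nat.card (A.fixedFiber x.1 K) := by
  have := Fintype.ofFinite {x // f x = y}
  rw [finsum_eq_sum_of_fintype, ← Nat.card_sigma]
  exact Nat.card_congr
    { toFun := fun z => ⟨⟨A.map z.1, z.2.1⟩, z.1, rfl, z.2.2⟩
      invFun := fun z => ⟨z.2.1, (congrArg f z.2.2.1).trans z.1.2, z.2.2.2⟩
      left_inv := fun _ => rfl
      right_inv := by
        rintro ⟨⟨x, hx⟩, a, ha, ha'⟩
        obtain rfl : A.map a = x := ha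
        rfl }

/-- The `K`-orbits in the fibre of `f` over `y`. -/
abbrev FiberOrbits (f : X →[G] Y) (y : Y) (K : Subgroup G) : Type u :=
  {O : MulAction.orbitRel.Quotient K X // f O.out = y}

/-- A `K`-fixed point of `Π_f(A)` over `y` is a `K`-equivariant section over `f⁻¹(y)`. It is
determined by its value at one representative of each `K`-orbit, and that value can be any point
above the representative fixed by the representative's stabilizer in `K`. -/
theorem card_fixedFiber_sections [Finite X] [Finite Y] (f : X →[G] Y) (A : GSetOver G X) {y : Y}
    {K : Subgroup G} (h : K ≤ MulAction.stabilizer G y) :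
    Nat.card ((A.sections f).fixedFiber y K) =
      ∏ᶠ O : FiberOrbits f y K,
        Nat.card (A.fixedFiber O.1.out (K ⊓ MulAction.stabilizer G O.1.out)) := by
  have := Fintype.ofFinite (FiberOrbits f y K)
  rw [finprod_eq_prod_of_fintype, ← Nat.card_pi]
  have hmk : ∀ x : X, ∃ k ∈ K, k • (Quotient.mk (MulAction.orbitRel K X) x).out = x := fun x => by
    obtain ⟨k, hk⟩ := MulAction.orbitRel_apply.1
      (@Quotient.mk_out X (MulAction.orbitRel K X) x)
    refine ⟨(k : G)⁻¹, K.inv_mem k.2, ?_⟩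
    rw [inv_smul_eq_iff]
    exact hk.symm
  choose k hkK hk using hmk
  have hf : ∀ x, f x = y → f (Quotient.mk (MulAction.orbitRel K X) x).out = y := fun x hx => by
    have h1 := congrArg f (hk x)
    rw [map_smul, hx] at h1
    rw [← inv_smul_smul (k x) (f _), h1]
    exact h (K.inv_mem (hkK x))
  have hfix : ∀ (s : Section f A), s ∈ (A.sections f).fixedFiber y K → ∀ g ∈ K, ∀ x hx hx',
      g • s.toFun x hx = s.toFun (g • x) hx' := by
    intro s hs g hg x hx hx'
    have h1 : g • s = s := hs.2 g hg
    -- The domain proof depends on the section, so `g • s = s` is used through a general `t` instead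
    -- of by rewriting.
    have h2 : ∀ t : Section f A, t = s → ∀ ht, t.toFun (g • x) ht = s.toFun (g • x) hx' := by
      rintro _ rfl _; rfl
    rw [← h2 _ h1 (by rw [h1]; exact hx'), Section.smul_toFun]
    exact congrArg (g • ·) (s.toFun_congr (inv_smul_smul g x).symm _ _)
  refine Nat.card_eq_of_bijective (fun s O => ⟨s.1.toFun O.1.out (O.2.trans s.2.1.symm),
    s.1.map_toFun _ _, fun g hg => ?_⟩) ⟨?_, ?_⟩
  · have hg2 : g • O.1.out = O.1.out := hg.2
    rw [hfix s.1 s.2 g hg.1 _ _ (by rw [hg2]; exact O.2.trans s.2.1.symm)]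
    exact s.1.toFun_congr hg2 _ _
  · rintro ⟨s, hs⟩ ⟨t, ht⟩ hst
    refine Subtype.ext (Section.ext' (hs.1.trans ht.1.symm) fun x h1 h2 => ?_)
    have hx : f x = y := h1.trans hs.1
    have h3 := congrArg Subtype.val (congrFun hst ⟨_, hf x hx⟩)
    have h4 := congrArg (k x • ·) h3
    simp only at h4
    rw [hfix s hs _ (hkK x) _ _ (by rw [hk x]; exact h1),
      hfix t ht _ (hkK x) _ _ (by rw [hk x]; exact h2), s.toFun_congr (hk x) _ h1,
      t.toFun_congr (hk x) _ h2] at h4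
    exact h4
  · intro α
    -- The section is extended from representatives by translating with the chosen `k x`.
    -- Equivariance holds because two group elements taking the representative to `x` differ by an
    -- element of its stabilizer, which fixes the prescribed value.
    have hα : ∀ x hx x' hx', ∀ g ∈ K, g • x' = x →
        k x • (α ⟨_, hf x hx⟩).1 = g • k x' • (α ⟨_, hf x' hx'⟩).1 := by
      intro x hx x' hx' g hg hgx
      have h1 : Quotient.mk (MulAction.orbitRel K X) x =
          Quotient.mk (MulAction.orbitRel K X) x' :=
        Quotient.sound (MulAction.orbitRel_apply.2 ⟨⟨g, hg⟩, hgx⟩)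
      have h2 : (⟨_, hf x hx⟩ : FiberOrbits f y K) = ⟨_, hf x' hx'⟩ := Subtype.ext h1
      have h3 : ∀ O O' : FiberOrbits f y K, O = O' → (α O).1 = (α O').1 := by
        rintro _ _ rfl; rfl
      rw [h3 _ _ h2, smul_smul, eq_comm, ← eq_inv_smul_iff, eq_comm, smul_smul]
      refine (α ⟨_, hf x' hx'⟩).2.2 _ ⟨?_, ?_⟩
      · exact K.mul_mem (K.inv_mem (K.mul_mem hg (hkK x'))) (hkK x)
      · have h4 := hk x
        rw [h1] at h4
        change ((g * k x')⁻¹ * k x) • (Quotient.mk (MulAction.orbitRel K X) x').out = _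
        rw [mul_smul, h4, inv_smul_eq_iff, mul_smul, hk x', hgx]
    refine ⟨⟨⟨y, fun x hx => k x • (α ⟨_, hf x hx⟩).1, fun x hx => ?_⟩, rfl, fun g hg => ?_⟩, ?_⟩
    · rw [map_smul, (α ⟨_, hf x hx⟩).2.1]
      exact hk x
    · refine Section.ext' (h hg) fun x h1 h2 => ?_
      have hx : f x = y := h2
      have hx' : f (g⁻¹ • x) = y := by
        rw [map_smul, hx]
        exact h (K.inv_mem hg)
      exact (hα _ hx _ hx' g hg (smul_inv_smul g x)).symm
    · funext O
      refine Subtype.ext ?_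
      obtain ⟨O, hO⟩ := O
      have h1 : Quotient.mk (MulAction.orbitRel K X) O.out = O := Quotient.out_eq O
      have h3 : ∀ O O' : FiberOrbits f y K, O = O' → (α O).1 = (α O').1 := by
        rintro _ _ rfl; rfl
      change k O.out • (α ⟨_, _⟩).1 = _
      rw [h3 ⟨_, hf O.out hO⟩ ⟨O, hO⟩ (Subtype.ext h1)]
      refine (α ⟨O, hO⟩).2.2 _ ⟨hkK _, ?_⟩
      have h2 := hk O.out
      rw [h1] at h2
      exact h2

end GSetOver

/-! ### Products of polynomial maps -/

namespace IsPolynomialMap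

variable {M : Type*} [AddCommMonoid M]

theorem comp_addMonoidHom {N N' : Type*} [AddCommGroup N] [AddCommGroup N'] {f : M → N}
    (hf : IsPolynomialMap f) (g : N →+ N') : IsPolynomialMap fun a => g (f a) := by
  obtain ⟨n, hn⟩ := hf
  have key : ∀ b a k, (fwdDiff b)^[k] (fun a => g (f a)) a = g ((fwdDiff b)^[k] f a) := by
    intro b a k
    induction k generalizing a with
    | zero => rfl
    | succ k ih => simp only [Function.iterate_succ_apply', fwdDiff, ih, map_sub]
  exact ⟨n, fun b a => by rw [key, hn, map_zero]⟩

/-- Induction by the Leibniz rule `Δ(fg) = Δf g + f Δg + Δf Δg`. In the last term both orders have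
dropped, so the vanishing order of `Δf` is raised by one to keep the sum equal to `n`. -/
theorem fwdDiff_mul_iterate {R : Type*} [CommRing R] (b : M) {n : ℕ} :
    ∀ {k l : ℕ} {f g : M → R}, k + l = n → (fwdDiff b)^[k] f = 0 → (fwdDiff b)^[l] g = 0 →
      (fwdDiff b)^[n] (f * g) = 0 := by
  induction n with
  | zero =>
    intro k l f g h hf hg
    obtain rfl : k = 0 := by omega
    rw [Function.iterate_zero, id] at hf
    rw [hf, zero_mul, iterate_zero]
  | succ n ih =>
    intro k l f g h hf hg
    rcases k with _ | k
    · rw [Function.iterate_zero, id] at hf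
      rw [hf, zero_mul, iterate_zero]
    rcases l with _ | l
    · rw [Function.iterate_zero, id] at hg
      rw [hg, mul_zero, iterate_zero]
    have h1 : fwdDiff b (f * g) =
        fwdDiff b f * g + (f * fwdDiff b g + fwdDiff b f * fwdDiff b g) := by
      funext a
      simp only [fwdDiff, Pi.mul_apply, Pi.add_apply]
      ring
    have hf' : (fwdDiff b)^[k] (fwdDiff b f) = 0 := hf
    have hg' : (fwdDiff b)^[l] (fwdDiff b g) = 0 := hg
    have hf'' : (fwdDiff b)^[k + 1] (fwdDiff b f) = 0 := by
      rw [Function.iterate_succ_apply', hf']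
      exact iterate_zero b 1
    rw [Function.iterate_succ_apply, h1, ← fwdDiff_aux.coe_fwdDiffₗ_pow, map_add, map_add,
      fwdDiff_aux.coe_fwdDiffₗ_pow, ih (k := k) (l := l + 1) (by omega) hf' hg,
      ih (k := k + 1) (l := l) (by omega) hf hg',
      ih (k := k + 1) (l := l) (by omega) hf'' hg', add_zero, add_zero]

theorem mul {R : Type*} [CommRing R] {f g : M → R} (hf : IsPolynomialMap f)
    (hg : IsPolynomialMap g) : IsPolynomialMap (f * g) := by
  obtain ⟨m, hm⟩ := hf
  obtain ⟨n, hn⟩ := hg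
  exact ⟨m + n, fun b => congrFun (fwdDiff_mul_iterate b rfl (funext (hm b)) (funext (hn b)))⟩

theorem prod {R ι : Type*} [CommRing R] (s : Finset ι) {f : ι → M → R}
    (hf : ∀ i ∈ s, IsPolynomialMap (f i)) : IsPolynomialMap (∏ i ∈ s, f i) := by
  refine Finset.prod_induction f IsPolynomialMap (fun _ _ => mul) ⟨1, fun b a => ?_⟩ hf
  simp [fwdDiff]

theorem of_addMonoidHom {N N' : Type*} [AddCommGroup N] [AddCommGroup N'] (g : N →+ N') :
    IsPolynomialMap g :=
  ⟨2, fun b a => by simp [fwdDiff]⟩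

end IsPolynomialMap

/-! ### Marks and their behaviour under the operations -/

namespace BurnsideSemiring

open GSetOver

variable {G : Type u} [Group G] {X : Type u} [MulAction G X]

/-- The number of points over `x` that are fixed by `K`. -/
noncomputable def mark (x : X) (K : Subgroup G) : BurnsideSemiring G X → ℕ :=
  Quotient.lift (fun A => Nat.card (A.fixedFiber x K)) fun _ _ h => card_fixedFiber_congr h x K

theorem mark_zero (x : X) (K : Subgroup G) : mark x K (0 : BurnsideSemiring G X) = 0 := by
  have : IsEmpty ((GSetOver.empty : GSetOver G X).fixedFiber x K) := ⟨fun a => a.1.elim⟩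
  exact Nat.card_of_isEmpty

theorem mark_add (x : X) (K : Subgroup G) (a b : BurnsideSemiring G X) :
    mark x K (a + b) = mark x K a + mark x K b := by
  induction a using Quotient.inductionOn with | _ A
  induction b using Quotient.inductionOn with | _ B
  exact card_fixedFiber_sum A B x K

end BurnsideSemiring

namespace BurnsideRing

open GrothendieckRing GSetOver

variable {G : Type u} [Group G] {X Y : Type u} [MulAction G X] [MulAction G Y] [Finite X]
  [Finite Y]

/-- The mark homomorphism `Ω_G(X) → ℤ` that counts the points over `x` fixed by `K`. -/
noncomputable def mark (x : X) (K : Subgroup G) : BurnsideRing G X →+ ℤ :=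
  lift ((Nat.castAddMonoidHom ℤ).comp
    { toFun := BurnsideSemiring.mark x K
      map_zero' := BurnsideSemiring.mark_zero x K
      map_add' := BurnsideSemiring.mark_add x K })

theorem mark_cls (x : X) (K : Subgroup G) (A : GSetOver G X) :
    mark x K (cls A) = Nat.card (A.fixedFiber x K) :=
  lift_of _ _

theorem exists_eq_cls_sub (a : BurnsideRing G X) : ∃ A B : GSetOver G X, a = cls A - cls B := by
  obtain ⟨a, b, rfl⟩ := exists_eq_sub a
  induction a using Quotient.inductionOn with | _ A
  induction b using Quotient.inductionOn with | _ B
  exact ⟨A, B, rfl⟩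

theorem cls_mul (A B : GSetOver G X) : cls A * cls B = cls (A.prod B) :=
  (of_mul _ _).symm

theorem one_eq_cls : (1 : BurnsideRing G X) = cls terminal := rfl

theorem mark_mul (x : X) (K : Subgroup G) (a b : BurnsideRing G X) :
    mark x K (a * b) = mark x K a * mark x K b := by
  obtain ⟨A, B, rfl⟩ := exists_eq_cls_sub a
  obtain ⟨C, D, rfl⟩ := exists_eq_cls_sub b
  simp only [sub_mul, mul_sub, cls_mul, map_sub, mark_cls, card_fixedFiber_prod, Nat.cast_mul]

theorem mark_one {x : X} {K : Subgroup G} (h : K ≤ MulAction.stabilizer G x) :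
    mark x K (1 : BurnsideRing G X) = 1 := by
  rw [one_eq_cls, mark_cls, card_fixedFiber_terminal h, Nat.cast_one]

theorem mark_eq_zero {x : X} {K : Subgroup G} (h : ¬ K ≤ MulAction.stabilizer G x)
    (a : BurnsideRing G X) : mark x K a = 0 := by
  obtain ⟨A, B, rfl⟩ := exists_eq_cls_sub a
  rw [map_sub, mark_cls, mark_cls, card_fixedFiber_eq_zero A h, card_fixedFiber_eq_zero B h,
    sub_self]

/-- The mark at a subgroup of the stabilizer, as a ring homomorphism. -/
noncomputable def markHom {x : X} {K : Subgroup G} (h : K ≤ MulAction.stabilizer G x) :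
    BurnsideRing G X →+* ℤ where
  __ := mark x K
  map_one' := mark_one h
  map_mul' := mark_mul x K

theorem markHom_apply {x : X} {K : Subgroup G} (h : K ≤ MulAction.stabilizer G x)
    (a : BurnsideRing G X) : markHom h a = mark x K a := rfl

theorem mark_intCast {x : X} {K : Subgroup G} (h : K ≤ MulAction.stabilizer G x) (n : ℤ) :
    mark x K (n : BurnsideRing G X) = n := by
  rw [← markHom_apply h, map_intCast, Int.cast_id]

theorem mark_intCast_mul (x : X) (K : Subgroup G) (n : ℤ) (a : BurnsideRing G X) :
    mark x K ((n : BurnsideRing G X) * a) = n * mark x K a := by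
  rw [← zsmul_eq_mul, map_zsmul, smul_eq_mul]

theorem mark_res (f : X →[G] Y) (b : BurnsideRing G Y) {x : X} {K : Subgroup G}
    (h : K ≤ MulAction.stabilizer G x) : mark x K (res f b) = mark (f x) K b := by
  obtain ⟨A, B, rfl⟩ := exists_eq_cls_sub b
  simp only [map_sub, res_cls, mark_cls, card_fixedFiber_pullback f _ h]

theorem mark_ind (f : X →[G] Y) (a : BurnsideRing G X) (y : Y) (K : Subgroup G) :
    mark y K (ind f a) = ∑ᶠ x : {x // f x = y}, mark x.1 K a := by
  have := Fintype.ofFinite {x // f x = y}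
  obtain ⟨A, B, rfl⟩ := exists_eq_cls_sub a
  simp only [map_sub, ind_cls, mark_cls, card_fixedFiber_pushforward, finsum_eq_sum_of_fintype,
    Nat.cast_sum, Finset.sum_sub_distrib]

theorem mark_ind_of_isEmpty (f : X →[G] Y) (a : BurnsideRing G X) {y : Y} (hy : ∀ x, f x ≠ y)
    (K : Subgroup G) : mark y K (ind f a) = 0 := by
  have : IsEmpty {x // f x = y} := ⟨fun x => hy x.1 x.2⟩
  rw [mark_ind, finsum_of_isEmpty]

theorem mark_ind_res (f : X →[G] Y) (hf : Function.Injective f) (b : BurnsideRing G Y) (x : X)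
    (K : Subgroup G) : mark (f x) K (ind f (res f b)) = mark (f x) K b := by
  by_cases hK : K ≤ MulAction.stabilizer G (f x)
  · have : Unique {x' // f x' = f x} := ⟨⟨⟨x, rfl⟩⟩, fun x' => Subtype.ext (hf x'.2)⟩
    rw [mark_ind, finsum_unique, hf (default : {x' // f x' = f x}).2]
    refine mark_res f b (x := x) fun g hg => hf ?_
    rw [map_smul]
    exact hK hg
  · rw [mark_eq_zero hK, mark_eq_zero hK]

/-- Both sides are polynomial in `a`, the right one as a product of additive maps, and they agree on
classes of actual `G`-sets by `card_fixedFiber_sections`. Polynomial maps on a Grothendieck ring are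
determined by such values. -/
theorem mark_jnd (f : X →[G] Y) (a : BurnsideRing G X) {y : Y} {K : Subgroup G}
    (h : K ≤ MulAction.stabilizer G y) :
    mark y K (jnd f a) =
      ∏ᶠ O : FiberOrbits f y K, mark O.1.out (K ⊓ MulAction.stabilizer G O.1.out) a := by
  have := Fintype.ofFinite (FiberOrbits f y K)
  simp only [finprod_eq_prod_of_fintype]
  have h1 := (isPolynomialMap_jnd f).comp_addMonoidHom (mark y K)
  have h2 : IsPolynomialMap (∏ O : FiberOrbits f y K,
      (mark O.1.out (K ⊓ MulAction.stabilizer G O.1.out) : BurnsideRing G X → ℤ)) :=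
    IsPolynomialMap.prod _ fun _ _ => IsPolynomialMap.of_addMonoidHom _
  have h3 := congrFun (h1.ext h2 fun s => ?_) a
  · rw [h3, Finset.prod_apply]
  · induction s using Quotient.inductionOn with | _ A
    change mark y K (jnd f (cls A)) = _
    rw [jnd_cls, mark_cls, card_fixedFiber_sections f A h, finprod_eq_prod_of_fintype,
      Finset.prod_apply, Nat.cast_prod]
    exact Finset.prod_congr rfl fun O _ => (mark_cls _ _ A).symm

end BurnsideRing

/-! ### Burnside's theorem: marks separate elements -/

namespace GSetOver

variable {G : Type u} [Group G] {X Y : Type u} [MulAction G X] [MulAction G Y]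

/-- The restriction of `A → X` to a `G`-stable subset of `A`. -/
def restrict (A : GSetOver G X) (S : Set A.carrier) (hS : ∀ (g : G), ∀ a ∈ S, g • a ∈ S) :
    GSetOver G X where
  carrier := ({ carrier := S, smul_mem' := fun g a h => hS g a h } : SubMulAction G A.carrier)
  map :=
    { toFun := fun a => A.map a.1
      map_smul' := fun g a => map_smul A.map g a.1 }

theorem sum_restrict_compl_iso (A : GSetOver G X) (S : Set A.carrier)
    (hS : ∀ (g : G), ∀ a ∈ S, g • a ∈ S) (hS' : ∀ (g : G), ∀ a ∈ Sᶜ, g • a ∈ Sᶜ) :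
    Iso ((A.restrict S hS).sum (A.restrict Sᶜ hS')) A := by
  refine Iso.of_bijective (Sum.elim (fun a => a.1) (fun a => a.1)) ⟨?_, fun a => ?_⟩ ?_ ?_
  · rintro (⟨a, ha⟩ | ⟨a, ha⟩) (⟨b, hb⟩ | ⟨b, hb⟩) h <;> obtain rfl : a = b := h
    · rfl
    · exact (hb ha).elim
    · exact (ha hb).elim
    · rfl
  · by_cases ha : a ∈ S
    · exact ⟨Sum.inl ⟨a, ha⟩, rfl⟩
    · exact ⟨Sum.inr ⟨a, ha⟩, rfl⟩
  · rintro g (a | a) <;> rfl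
  · rintro (a | a) <;> rfl

theorem smul_mem_orbit_compl {A : Type*} [MulAction G A] (a : A) (g : G) (b : A)
    (hb : b ∈ (MulAction.orbit G a)ᶜ) : g • b ∈ (MulAction.orbit G a)ᶜ := fun h =>
  hb (by simpa using MulAction.mem_orbit_of_mem_orbit g⁻¹ h)

/-- The isomorphism is `g • a ↦ g • b`; equality of stabilizers makes it both well defined and
injective. -/
theorem restrict_orbit_iso {A B : GSetOver G X} {a : A.carrier} {b : B.carrier}
    (hab : B.map b = A.map a) (h : MulAction.stabilizer G a = MulAction.stabilizer G b) :
    Iso (A.restrict (MulAction.orbit G a) fun g _ hc => MulAction.mem_orbit_of_mem_orbit g hc)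
      (B.restrict (MulAction.orbit G b) fun g _ hc => MulAction.mem_orbit_of_mem_orbit g hc) := by
  have key : ∀ g g' : G, g • a = g' • a ↔ g • b = g' • b := fun g g' => by
    rw [← inv_smul_eq_iff, smul_smul, ← MulAction.mem_stabilizer_iff, h,
      MulAction.mem_stabilizer_iff, ← smul_smul, inv_smul_eq_iff]
  have hγ : ∀ z : MulAction.orbit G a, ∃ g : G, g • a = z := fun z => z.2
  choose γ hγ using hγ
  refine Iso.of_bijective (fun z => ⟨γ z • b, MulAction.mem_orbit _ _⟩) ⟨?_, ?_⟩ ?_ ?_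
  · intro z z' hz
    have h1 : γ z • b = γ z' • b := congrArg Subtype.val hz
    exact Subtype.ext (by rw [← hγ z, ← hγ z', (key _ _).2 h1])
  · rintro ⟨_, g, rfl⟩
    exact ⟨⟨g • a, MulAction.mem_orbit _ _⟩, Subtype.ext ((key _ _).1 (hγ ⟨g • a, _⟩))⟩
  · intro g z
    refine Subtype.ext ?_
    change γ _ • b = g • γ z • b
    rw [smul_smul, ← key]
    refine (hγ _).trans ?_
    rw [mul_smul]
    exact congrArg (g • ·) (hγ z).symm
  · intro z
    change B.map (γ z • b) = A.map z.1
    rw [map_smul, hab, ← map_smul]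
    exact congrArg A.map (hγ z)

theorem restrict_orbit_compl_card_lt {A : GSetOver G X} (a : A.carrier) :
    Nat.card (A.restrict (MulAction.orbit G a)ᶜ (smul_mem_orbit_compl a)).carrier <
      Nat.card A.carrier :=
  Set.ncard_lt_card fun h =>
    (h.ge (Set.mem_univ a) : a ∈ (MulAction.orbit G a)ᶜ) (MulAction.mem_orbit_self a)

/-- Burnside's theorem: the numbers of fixed points determine a finite `G`-set over `X`. -/
theorem iso_of_card_fixedFiber [Finite G] {A B : GSetOver G X}
    (h : ∀ x K, Nat.card (A.fixedFiber x K) = Nat.card (B.fixedFiber x K)) : Iso A B := by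
  induction hn : Nat.card A.carrier using Nat.strong_induction_on generalizing A B with
  | _ n ih =>
  -- The point `c` is itself counted by the mark at its own stabilizer, so the equal mark of `D` is
  -- nonzero.
  have hlift : ∀ {C D : GSetOver G X}, (∀ x K, Nat.card (C.fixedFiber x K) =
      Nat.card (D.fixedFiber x K)) → ∀ c : C.carrier, ∃ d : D.carrier, D.map d = C.map c ∧
        MulAction.stabilizer G c ≤ MulAction.stabilizer G d := by
    intro C D hCD c
    have h1 : Nat.card (D.fixedFiber (C.map c) (MulAction.stabilizer G c)) ≠ 0 := by
      rw [← hCD]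
      have : Nonempty (C.fixedFiber (C.map c) (MulAction.stabilizer G c)) :=
        ⟨⟨c, rfl, fun g hg => hg⟩⟩
      exact Nat.card_pos.ne'
    obtain ⟨⟨d, hd⟩⟩ := (Nat.card_ne_zero.1 h1).1
    exact ⟨d, hd.1, fun g hg => hd.2 g hg⟩
  rcases isEmpty_or_nonempty A.carrier with hA | hA
  · have hB : IsEmpty B.carrier := ⟨fun b => hA.elim (hlift (fun x K => (h x K).symm) b).choose⟩
    exact ⟨Equiv.equivOfIsEmpty _ _, fun _ a => hA.elim a, fun a => hA.elim a⟩
  -- Lifting a point `a` with largest stabilizer to `B` and back to `A` can only enlarge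
  -- stabilizers, so by maximality they are all equal. The orbits of `a` and `b` are then
  -- isomorphic, and the induction continues on their complements.
  obtain ⟨a, ha⟩ := Finite.exists_max fun a : A.carrier => Nat.card (MulAction.stabilizer G a)
  obtain ⟨b, hb, hab⟩ := hlift h a
  obtain ⟨a', _, hba⟩ := hlift (fun x K => (h x K).symm) b
  have hstab : MulAction.stabilizer G a = MulAction.stabilizer G b :=
    Subgroup.eq_of_le_of_card_ge hab
      ((Nat.card_le_card_of_injective _ (Subgroup.inclusion_injective hba)).trans (ha a'))
  have h1 := restrict_orbit_iso hb hstab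
  have hA' := sum_restrict_compl_iso A (MulAction.orbit G a)
    (fun g _ hc => MulAction.mem_orbit_of_mem_orbit g hc) (smul_mem_orbit_compl a)
  have hB' := sum_restrict_compl_iso B (MulAction.orbit G b)
    (fun g _ hc => MulAction.mem_orbit_of_mem_orbit g hc) (smul_mem_orbit_compl b)
  have h2 := ih _ (hn ▸ restrict_orbit_compl_card_lt a)
    (B := B.restrict _ (smul_mem_orbit_compl b)) (fun x K => ?_) rfl
  · exact hA'.symm.trans ((h1.sum h2).trans hB')
  · have h3 := h x K
    rw [← card_fixedFiber_congr hA', ← card_fixedFiber_congr hB', card_fixedFiber_sum,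
      card_fixedFiber_sum, card_fixedFiber_congr h1] at h3
    omega

theorem card_fiberOrbits_le [Finite X] (f : X →[G] Y) (y : Y) (K : Subgroup G) :
    Nat.card (FiberOrbits f y K) ≤ Nat.card {x // f x = y} :=
  Nat.card_le_card_of_injective (fun O => ⟨O.1.out, O.2⟩) fun _ _ h =>
    Subtype.ext (Quotient.out_injective (congrArg Subtype.val h))

theorem fiberOrbits_nonempty (f : X →[G] Y) {x : X} {y : Y} (hx : f x = y) {K : Subgroup G}
    (hK : K ≤ MulAction.stabilizer G y) : Nonempty (FiberOrbits f y K) := by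
  obtain ⟨k, hk⟩ := MulAction.orbitRel_apply.1 (@Quotient.mk_out X (MulAction.orbitRel K X) x)
  refine ⟨Quotient.mk (MulAction.orbitRel K X) x, ?_⟩
  rw [← hk]
  change f ((k : G) • x) = y
  rw [map_smul, hx]
  exact hK k.2

end GSetOver

/-! ### Multiplicative transfers and reduction to orbits -/

namespace BurnsideRing

open GSetOver

variable {G : Type u} [Group G] [Finite G] {X Y : Type u} [MulAction G X] [MulAction G Y]
  [Finite X] [Finite Y]

/-- Write `a - b` as a difference of two `G`-sets. These have equal fixed-point counts, also at
subgroups not stabilizing the point, where all counts vanish, so they are isomorphic. -/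
theorem ext_mark {a b : BurnsideRing G X}
    (h : ∀ x, ∀ K ≤ MulAction.stabilizer G x, mark x K a = mark x K b) : a = b := by
  rw [← sub_eq_zero]
  obtain ⟨A, B, hAB⟩ := exists_eq_cls_sub (a - b)
  rw [hAB, sub_eq_zero]
  refine congrArg GrothendieckRing.of (BurnsideSemiring.sound (iso_of_card_fixedFiber ?_))
  intro x K
  have h1 : mark x K (a - b) = 0 := by
    by_cases hK : K ≤ MulAction.stabilizer G x
    · rw [map_sub, h x K hK, sub_self]
    · exact mark_eq_zero hK _
  rw [hAB, map_sub, mark_cls, mark_cls, sub_eq_zero] at h1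
  exact_mod_cast h1

theorem jnd_mul (f : X →[G] Y) (a b : BurnsideRing G X) : jnd f (a * b) = jnd f a * jnd f b := by
  refine ext_mark fun y K hK => ?_
  rw [mark_mul, mark_jnd f _ hK, mark_jnd f _ hK, mark_jnd f _ hK,
    ← finprod_mul_distrib (Set.toFinite _) (Set.toFinite _)]
  simp only [mark_mul]

/-- `a ↦ v_• w^* a - v_• 0` is multiplicative. -/
theorem jnd_res_sub_mul {Z : Type u} [MulAction G Z] [Finite Z] (v : Y →[G] Z) (w : Y →[G] X)
    (a b : BurnsideRing G X) :
    jnd v (res w (a * b)) - jnd v 0 =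
      (jnd v (res w a) - jnd v 0) * (jnd v (res w b) - jnd v 0) := by
  -- Because `v_• 0` absorbs every `v_• c`, the cross terms in the expanded product collapse to a
  -- single `v_• 0`.
  have h1 : ∀ c, jnd v c * jnd v 0 = jnd v 0 := fun c => by rw [← jnd_mul, mul_zero]
  rw [map_mul, jnd_mul, sub_mul, mul_sub, mul_sub, h1, h1, mul_comm (jnd v 0), h1]
  ring

/-- If all relevant marks of `a` are equal to `β`, the marks of `f_• a` are powers of `β`. -/
theorem mark_jnd_eq_pow (f : X →[G] Y) (a : BurnsideRing G X) {y : Y} {K : Subgroup G}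
    (hK : K ≤ MulAction.stabilizer G y) {β : ℤ}
    (h : ∀ x, f x = y → mark x (K ⊓ MulAction.stabilizer G x) a = β) :
    mark y K (jnd f a) = β ^ Nat.card (FiberOrbits f y K) := by
  have := Fintype.ofFinite (FiberOrbits f y K)
  rw [mark_jnd f a hK, finprod_eq_prod_of_fintype, Nat.card_eq_fintype_card]
  exact Finset.prod_eq_pow_card fun O _ => h _ O.2

theorem mark_jnd_zero (f : X →[G] Y) {x : X} {y : Y} (hx : f x = y) {K : Subgroup G}
    (hK : K ≤ MulAction.stabilizer G y) : mark y K (jnd f 0) = 0 := by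
  have := fiberOrbits_nonempty f hx hK
  rw [mark_jnd_eq_pow f 0 hK fun _ _ => map_zero _, zero_pow Nat.card_pos.ne']

theorem mark_jnd_of_isEmpty (f : X →[G] Y) (a : BurnsideRing G X) {y : Y} {K : Subgroup G}
    (hK : K ≤ MulAction.stabilizer G y) (hy : ∀ x, f x ≠ y) : mark y K (jnd f a) = 1 := by
  rw [mark_jnd_eq_pow f a hK (β := 1) fun x hx => (hy x hx).elim]
  exact one_pow _

end BurnsideRing

/-- The inclusion of an orbit. -/
def orbitIncl {G : Type u} [Group G] {X : Type u} [MulAction G X]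
    (O : MulAction.orbitRel.Quotient G X) : O.orbit →[G] X where
  toFun := Subtype.val
  map_smul' := fun _ _ => rfl

namespace BurnsideIdeal

open BurnsideRing

variable {G : Type u} [Group G]

theorem isTransitive_orbit {X : Type u} [MulAction G X] [Finite X]
    (O : MulAction.orbitRel.Quotient G X) : (FinGSet.of (G := G) O.orbit).IsTransitive :=
  ⟨(MulAction.orbitRel.Quotient.nonempty_orbit O).to_subtype, inferInstance⟩

/-- Membership in an ideal can be tested on orbits. -/
theorem mem_of_orbits [Finite G] (I : BurnsideIdeal G) (X : FinGSet G) (c : BurnsideRing G X)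
    (h : ∀ O : MulAction.orbitRel.Quotient G X,
      res (orbitIncl O) c ∈ I.ideal (FinGSet.of O.orbit)) : c ∈ I.ideal X := by
  classical
  have := Fintype.ofFinite (MulAction.orbitRel.Quotient G X)
  -- Here `c` is the sum of its restrictions extended by zero from each orbit; over a given point
  -- only the orbit of that point contributes a mark.
  have key : c = ∑ O : MulAction.orbitRel.Quotient G X,
      ind (orbitIncl O) (res (orbitIncl O) c) := by
    refine ext_mark fun x K hK => ?_
    rw [map_sum, Finset.sum_eq_single (Quotient.mk (MulAction.orbitRel G X) x)]
    · exact (mark_ind_res (orbitIncl (Quotient.mk (MulAction.orbitRel G X) x))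
        Subtype.val_injective c
        ⟨x, MulAction.orbitRel.Quotient.mem_orbit.2 rfl⟩ K).symm
    · intro O _ hO
      refine mark_ind_of_isEmpty _ _ (fun z hz => hO ?_) K
      rw [← MulAction.orbitRel.Quotient.mem_orbit.1 z.2]
      exact congrArg _ hz
    · exact fun h => (h (Finset.mem_univ _)).elim
  rw [key]
  exact Ideal.sum_mem _ fun O _ => I.ind_mem (FinGSet.of O.orbit) X (orbitIncl O) _ (h O)

end BurnsideIdeal

/-! ### Ideals defined by marks, and powers of ideals inside a prime ideal -/

namespace BurnsideIdeal

open BurnsideRing GSetOver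

section Group

variable {G : Type u} [Group G]

theorem le_def {I J : BurnsideIdeal G} : I ≤ J ↔ ∀ X, I.ideal X ≤ J.ideal X := Iff.rfl

theorem mul_jnd_res_sub_mem (I : BurnsideIdeal G) {X Y : FinGSet G} {a : BurnsideRing G X}
    {b : BurnsideRing G Y} (h : a ∈ I.ideal X ∨ b ∈ I.ideal Y) (C D D' : FinGSet G)
    (v : D →[G] C) (w : D →[G] X) (v' : D' →[G] C) (w' : D' →[G] Y) :
    (jnd v (res w a) - jnd v 0) * (jnd v' (res w' b) - jnd v' 0) ∈ I.ideal C := by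
  rcases h with h | h
  · exact Ideal.mul_mem_right _ _ (I.jnd_mem _ _ v _ (I.res_mem _ _ w _ h))
  · exact Ideal.mul_mem_left _ _ (I.jnd_mem _ _ v' _ (I.res_mem _ _ w' _ h))

/-- Products of `2 ^ n` elements of an ideal, bracketed as complete binary trees. -/
def binaryProducts (J : BurnsideIdeal G) : ℕ → ∀ X : FinGSet G, Set (BurnsideRing G X)
  | 0, X => J.ideal X
  | n + 1, X => {c | ∃ a ∈ binaryProducts J n X, ∃ b ∈ binaryProducts J n X, c = a * b}

theorem res_mem_binaryProducts (J : BurnsideIdeal G) (n : ℕ) {X Y : FinGSet G} (f : X →[G] Y)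
    {c : BurnsideRing G Y} (hc : c ∈ J.binaryProducts n Y) :
    res f c ∈ J.binaryProducts n X := by
  induction n generalizing c with
  | zero => exact J.res_mem _ _ f c hc
  | succ n ih =>
    obtain ⟨a, ha, b, hb, rfl⟩ := hc
    exact ⟨_, ih ha, _, ih hb, map_mul _ _ _⟩

/-- The operation `v_• w^* - v_• 0` is multiplicative but need not be additive. Products of elements
are therefore used in place of powers of ideals, and the binary bracketing matches the two factors
in the definition of a prime ideal. -/
theorem jnd_res_sub_mem_binaryProducts [Finite G] (J : BurnsideIdeal G) (n : ℕ) {X C D : FinGSet G}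
    (v : D →[G] C) (w : D →[G] X) {c : BurnsideRing G X} (hc : c ∈ J.binaryProducts n X) :
    jnd v (res w c) - jnd v 0 ∈ J.binaryProducts n C := by
  induction n generalizing c with
  | zero => exact J.jnd_mem _ _ v _ (J.res_mem _ _ w c hc)
  | succ n ih =>
    obtain ⟨a, ha, b, hb, rfl⟩ := hc
    exact ⟨_, ih ha, _, ih hb, jnd_res_sub_mul v w a b⟩

theorem binaryProducts_subset (J : BurnsideIdeal G) (n : ℕ) (X : FinGSet G) :
    J.binaryProducts n X ⊆ (J.ideal X ^ 2 ^ n : Ideal (BurnsideRing G X)) := by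
  induction n with
  | zero =>
    rw [pow_zero, pow_one]
    exact subset_rfl
  | succ n ih =>
    rintro _ ⟨a, ha, b, hb, rfl⟩
    rw [pow_succ, mul_two, pow_add]
    exact Ideal.mul_mem_mul (ih ha) (ih hb)

variable [Finite G]

/-- The ideal of all elements whose marks at subgroups of `H` lie in `q`. -/
def markIdeal (H : Subgroup G) (q : Ideal ℤ) : BurnsideIdeal G where
  ideal X :=
    { carrier := {a | ∀ x, ∀ K ≤ H, mark x K a ∈ q}
      add_mem' := fun ha hb x K hK => by
        rw [map_add]
        exact q.add_mem (ha x K hK) (hb x K hK)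
      zero_mem' := fun x K _ => by
        rw [map_zero]
        exact q.zero_mem
      smul_mem' := fun c a ha x K hK => by
        rw [smul_eq_mul, mark_mul]
        exact q.mul_mem_left _ (ha x K hK) }
  res_mem X Y f a ha x K hK := by
    by_cases h : K ≤ MulAction.stabilizer G x
    · rw [mark_res f a h]
      exact ha _ K hK
    · rw [mark_eq_zero h]
      exact q.zero_mem
  ind_mem X Y f a ha y K hK := by
    have := Fintype.ofFinite {x // f x = y}
    rw [mark_ind, finsum_eq_sum_of_fintype]
    exact q.sum_mem fun x _ => ha _ K hK
  jnd_mem X Y f a ha y K hK := by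
    by_cases h : K ≤ MulAction.stabilizer G y
    · rw [map_sub]
      -- Over a nonempty fibre, `f_• 0` has mark `0` and the mark of `f_• a` has at least one
      -- factor, which lies in `q`. Over an empty fibre, both marks are `1` and cancel.
      by_cases hy : ∃ x, f x = y
      · obtain ⟨x, hx⟩ := hy
        have := Fintype.ofFinite (FiberOrbits f y K)
        obtain ⟨O⟩ := fiberOrbits_nonempty f hx h
        rw [mark_jnd_zero f hx h, sub_zero, mark_jnd f a h, finprod_eq_prod_of_fintype]
        exact q.mem_of_dvd (Finset.dvd_prod_of_mem _ (Finset.mem_univ O))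
          (ha _ _ (inf_le_left.trans hK))
      · rw [mark_jnd_of_isEmpty f a h (not_exists.1 hy), mark_jnd_of_isEmpty f 0 h
          (not_exists.1 hy), sub_self]
        exact q.zero_mem
    · rw [mark_eq_zero h]
      exact q.zero_mem

theorem mem_markIdeal {H : Subgroup G} {q : Ideal ℤ} {X : FinGSet G} {a : BurnsideRing G X} :
    a ∈ (markIdeal H q).ideal X ↔ ∀ x, ∀ K ≤ H, mark x K a ∈ q := Iff.rfl

theorem markIdeal_mono {H H' : Subgroup G} {q q' : Ideal ℤ} (hH : H' ≤ H) (hq : q ≤ q') :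
    markIdeal H q ≤ markIdeal H' q' :=
  fun _ _ ha x K hK => hq (ha x K (hK.trans hH))

/-- A prime ideal that contains uniformly bounded powers of `J` contains `J`. -/
theorem IsPrime.le_of_pow_le {I J : BurnsideIdeal G} (hI : I.IsPrime) (m : ℕ)
    (h : ∀ X : FinGSet G, X.IsTransitive → J.ideal X ^ m ≤ I.ideal X) : J ≤ I := by
  have key : ∀ n, (∀ X : FinGSet G, X.IsTransitive → J.binaryProducts n X ⊆ I.ideal X) →
      J ≤ I := by
    intro n
    induction n with
    | zero =>
      intro hn X a ha
      exact I.mem_of_orbits X a fun O => hn _ (isTransitive_orbit O) (J.res_mem _ _ _ a ha)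
    | succ n ih =>
      -- Primality is applied to the pair `(c, c)`: each factor of the test product is again a
      -- product of `2 ^ n` elements of `J`, so the whole is one of `2 ^ (n + 1)` elements.
      refine fun hn => ih fun X hX c hc => or_self_iff.1 ((hI.2 X X hX hX c c).1 ?_)
      intro C D D' v w v' w'
      refine I.mem_of_orbits C _ fun O => hn _ (isTransitive_orbit O) ?_
      rw [map_mul]
      exact ⟨_, J.res_mem_binaryProducts n (X := FinGSet.of O.orbit) _
        (J.jnd_res_sub_mem_binaryProducts n v w hc), _,
        J.res_mem_binaryProducts n (X := FinGSet.of O.orbit) _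
        (J.jnd_res_sub_mem_binaryProducts n v' w' hc), rfl⟩
  exact key m fun X hX => (J.binaryProducts_subset m X).trans
    ((Ideal.pow_le_pow_right Nat.lt_two_pow_self.le).trans (h X hX))

end Group

end BurnsideIdeal

/-! ### Spreading an element to another `G`-set; primality of the mark ideals -/

section Spread

variable {G : Type u} [Group G] {X : Type u} [MulAction G X]

/-- The map `G/K → X`, `g K ↦ g x`, for `K` contained in the stabilizer of `x`. -/
def quotientTo {K : Subgroup G} {x : X} (h : K ≤ MulAction.stabilizer G x) : G ⧸ K →[G] X where
  toFun z := MulAction.ofQuotientStabilizer G x (Subgroup.quotientMapOfLE h z)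
  map_smul' := by
    rintro g ⟨z⟩
    exact mul_smul g z x

theorem quotientTo_mk {K : Subgroup G} {x : X} (h : K ≤ MulAction.stabilizer G x) (g : G) :
    quotientTo h (g : G ⧸ K) = g • x := rfl

end Spread

namespace BurnsideRing

open GSetOver

theorem stabilizer_quotient_eq {G : Type*} [CommGroup G] (K : Subgroup G) (z : G ⧸ K) :
    MulAction.stabilizer G z = K := by
  obtain ⟨g, rfl⟩ := QuotientGroup.mk_surjective z
  ext h
  rw [MulAction.mem_stabilizer_iff, MulAction.Quotient.smul_mk, QuotientGroup.eq,
    smul_eq_mul, mul_comm h g, mul_inv_rev, mul_assoc, inv_mul_cancel, mul_one, inv_mem_iff]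

variable {G : Type u} [CommGroup G] {X : Type u} [MulAction G X] [Finite X]

/-- Translation by `g` carries `K`-fixed points over `x` to those over `g • x`, with no conjugation
of `K` because `G` is commutative. -/
theorem mark_smul (g : G) (x : X) (K : Subgroup G) (a : BurnsideRing G X) :
    mark (g • x) K a = mark x K a := by
  obtain ⟨A, B, rfl⟩ := exists_eq_cls_sub a
  have key : ∀ A : GSetOver G X,
      Nat.card (A.fixedFiber (g • x) K) = Nat.card (A.fixedFiber x K) := fun A => by
    refine (Nat.card_congr ((MulAction.toPerm g).subtypeEquiv fun a => ?_)).symm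
    simp only [fixedFiber, Set.mem_ofPred_eq, MulAction.toPerm_apply, map_smul,
      smul_left_cancel_iff]
    refine and_congr Iff.rfl (forall₂_congr fun k _ => ?_)
    rw [smul_comm k g, smul_left_cancel_iff]
  simp only [map_sub, mark_cls, key]

variable [Finite G]

/-- The image of an element of `Ω_G(X)` in `Ω_G(C)` under restriction along
`G/K × C → G/K → X` and multiplicative transfer along `G/K × C → C`. -/
noncomputable def spread {K : Subgroup G} {x : X} (h : K ≤ MulAction.stabilizer G x) (C : Type u)
    [MulAction G C] [Finite C] (b : BurnsideRing G X) : BurnsideRing G C :=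
  jnd (MulActionHom.snd G (G ⧸ K) C) (res ((quotientTo h).comp (MulActionHom.fst G (G ⧸ K) C)) b) -
    jnd (MulActionHom.snd G (G ⧸ K) C) 0

/-- Every point of the fibre `G/K₀ × {y}` has stabilizer exactly `K₀` in `K`, so each `K`-orbit
contributes the same factor `mark x K₀ b`. The exponent is the number of these orbits; its bound
does not depend on `C`, which later gives uniform powers. -/
theorem mark_spread {K₀ : Subgroup G} {x : X} (h : K₀ ≤ MulAction.stabilizer G x) {C : Type u}
    [MulAction G C] [Finite C] (b : BurnsideRing G X) {y : C} {K : Subgroup G} (hK₀ : K₀ ≤ K)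
    (hK : K ≤ MulAction.stabilizer G y) :
    ∃ e ≤ Nat.card G, mark y K (spread h C b) = mark x K₀ b ^ e := by
  refine ⟨Nat.card (FiberOrbits (MulActionHom.snd G (G ⧸ K₀) C) y K), ?_, ?_⟩
  · refine (card_fiberOrbits_le _ _ _).trans (le_trans ?_
      (Nat.card_le_card_of_surjective _ (QuotientGroup.mk_surjective (s := K₀))))
    refine Nat.card_le_card_of_injective (fun z => z.1.1) ?_
    rintro ⟨⟨z, c⟩, hz⟩ ⟨⟨z', c'⟩, hz'⟩ hzz
    exact Subtype.ext (Prod.ext hzz (hz.trans hz'.symm))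
  · have h1 : MulActionHom.snd G (G ⧸ K₀) C (((1 : G) : G ⧸ K₀), y) = y := rfl
    rw [spread, map_sub, mark_jnd_zero _ h1 hK, sub_zero]
    refine mark_jnd_eq_pow _ _ hK ?_
    rintro ⟨z, c⟩ hc
    obtain rfl : c = y := hc
    have hstab : K ⊓ MulAction.stabilizer G (z, c) = K₀ := by
      ext g
      rw [Subgroup.mem_inf, MulAction.mem_stabilizer_iff, Prod.smul_mk, Prod.mk.injEq,
        ← MulAction.mem_stabilizer_iff, ← MulAction.mem_stabilizer_iff, stabilizer_quotient_eq]
      exact ⟨fun hg => hg.2.1, fun hg => ⟨hK₀ hg, hg, hK (hK₀ hg)⟩⟩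
    rw [mark_res _ _ inf_le_right, hstab]
    obtain ⟨g, rfl⟩ := QuotientGroup.mk_surjective z
    exact mark_smul g x K₀ b

end BurnsideRing

namespace BurnsideIdeal

open BurnsideRing

variable {G : Type u} [CommGroup G] [Finite G]

theorem spread_mem (I : BurnsideIdeal G) {X : FinGSet G} {b : BurnsideRing G X}
    (hb : b ∈ I.ideal X) {K : Subgroup G} {x : X} (h : K ≤ MulAction.stabilizer G x)
    (C : FinGSet G) : spread h C b ∈ I.ideal C :=
  I.jnd_mem (FinGSet.of ((G ⧸ K) × C)) C _ _ (I.res_mem (FinGSet.of ((G ⧸ K) × C)) X _ b hb)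

/-- If `a` and `b` each have a mark outside `q` at a subgroup of `H`, spreading both to `C = G/H`
gives elements whose marks at `H` are powers of those marks. The mark at `H` of their product is
then outside `q`. -/
theorem markIdeal_isPrime (H : Subgroup G) (q : Ideal ℤ) [hq : q.IsPrime] :
    (markIdeal H q).IsPrime := by
  refine ⟨⟨FinGSet.of (G ⧸ H), fun h => hq.ne_top ?_⟩, fun X Y hX hY a b =>
    ⟨fun h => ?_, fun h C D D' v w v' w' => mul_jnd_res_sub_mem _ h C D D' v w v' w'⟩⟩
  · have h1 := (Ideal.eq_top_iff_one _).1 h ((1 : G) : G ⧸ H) ⊥ bot_le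
    rw [mark_one bot_le] at h1
    exact (Ideal.eq_top_iff_one _).2 h1
  · by_contra! hab
    have key : ∀ (X : FinGSet G) (a : BurnsideRing G X), a ∉ (markIdeal H q).ideal X →
        ∃ (D : FinGSet G) (v : D →[G] G ⧸ H) (w : D →[G] X),
          mark ((1 : G) : G ⧸ H) H (jnd v (res w a) - jnd v 0) ∉ q := by
      intro X a ha
      simp only [mem_markIdeal, not_forall] at ha
      obtain ⟨x, K, hKH, hK⟩ := ha
      have hx : K ≤ MulAction.stabilizer G x := by
        by_contra hx
        exact hK (mark_eq_zero hx a ▸ q.zero_mem)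
      refine ⟨FinGSet.of ((G ⧸ K) × (G ⧸ H)), MulActionHom.snd G (G ⧸ K) (G ⧸ H),
        (quotientTo hx).comp (MulActionHom.fst G (G ⧸ K) (G ⧸ H)), fun h1 => hK ?_⟩
      obtain ⟨e, -, he⟩ := mark_spread hx (C := G ⧸ H) a hKH
        (stabilizer_quotient_eq H ((1 : G) : G ⧸ H)).ge
      exact hq.mem_of_pow_mem e (he ▸ h1)
    obtain ⟨D, v, w, h1⟩ := key X a hab.1
    obtain ⟨D', v', w', h2⟩ := key Y b hab.2
    have h3 := h (FinGSet.of (G ⧸ H)) D D' v w v' w' ((1 : G) : G ⧸ H) H le_rfl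
    rw [mark_mul] at h3
    exact (hq.mem_or_mem h3).elim h1 h2

end BurnsideIdeal

/-! ### Elements with prescribed marks -/

namespace BurnsideRing

open GSetOver

variable {G : Type u} [CommGroup G] [Finite G] {X : Type u} [MulAction G X] [Finite X]

section Transitive

variable [MulAction.IsPretransitive G X]

theorem ext_mark_of_isPretransitive (y : X) {a b : BurnsideRing G X}
    (h : ∀ K ≤ MulAction.stabilizer G y, mark y K a = mark y K b) : a = b := by
  refine ext_mark fun x K _ => ?_
  obtain ⟨g, rfl⟩ := MulAction.exists_smul_eq G y x
  rw [mark_smul, mark_smul]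
  by_cases hK : K ≤ MulAction.stabilizer G y
  · exact h K hK
  · rw [mark_eq_zero hK, mark_eq_zero hK]

/-- If the marks of an element `n` of an ideal are powers of `β` wherever those of `u` do not
vanish, then a bounded power of `β` multiplies `u` into the ideal. -/
theorem intCast_pow_mul_mem (J : Ideal (BurnsideRing G X)) (y : X) {n u : BurnsideRing G X}
    (hn : n ∈ J) (β : ℤ) (E : ℕ)
    (h : ∀ K ≤ MulAction.stabilizer G y, mark y K u = 0 ∨ ∃ e ≤ E, mark y K n = β ^ e) :
    ((β ^ (Nat.card (Subgroup G) * E) : ℤ) : BurnsideRing G X) * u ∈ J := by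
  classical
  have := Fintype.ofFinite (Subgroup G)
  let T : Finset (Subgroup G) := {K | K ≤ MulAction.stabilizer G y ∧ mark y K u ≠ 0}
  have hT : ∀ K, ∃ e, K ∈ T → e ≤ E ∧ mark y K n = β ^ e := fun K => by
    by_cases hK : K ∈ T
    · have hK' := (Finset.mem_filter_univ K).1 hK
      obtain ⟨e, he⟩ := (h K hK'.1).resolve_left hK'.2
      exact ⟨e, fun _ => he⟩
    · exact ⟨0, fun hK' => (hK hK').elim⟩
  choose e he using hT
  -- At each `K` either `u` or the factor indexed by `K` has mark zero. Modulo `J`, where `n`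
  -- vanishes, this identity says that a power of `β` kills `u`.
  have h0 : u * ∏ K ∈ T, (((β ^ e K : ℤ) : BurnsideRing G X) - n) = 0 := by
    refine ext_mark_of_isPretransitive y fun K hK => ?_
    rw [mark_mul, map_zero, mul_eq_zero]
    by_cases hu : mark y K u = 0
    · exact Or.inl hu
    · have hKT : K ∈ T := (Finset.mem_filter_univ K).2 ⟨hK, hu⟩
      right
      rw [← markHom_apply hK, map_prod]
      refine Finset.prod_eq_zero hKT ?_
      rw [markHom_apply, map_sub, mark_intCast hK, (he K hKT).2, sub_self]
  have h1 : ((β ^ ∑ K ∈ T, e K : ℤ) : BurnsideRing G X) * u ∈ J := by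
    rw [← Ideal.Quotient.eq_zero_iff_mem] at hn ⊢
    have h2 := congrArg (Ideal.Quotient.mk J) h0
    simp only [map_mul, map_prod, map_sub, hn, sub_zero, map_zero] at h2
    rw [map_mul, mul_comm, ← h2, ← Finset.prod_pow_eq_pow_sum, Int.cast_prod, map_prod]
  have h3 : ∑ K ∈ T, e K ≤ Nat.card (Subgroup G) * E := by
    refine (Finset.sum_le_card_nsmul T e E fun K hK => (he K hK).1).trans ?_
    rw [smul_eq_mul, Nat.card_eq_fintype_card]
    exact Nat.mul_le_mul_right _ (Finset.card_le_univ T)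
  obtain ⟨d, hd⟩ := Nat.exists_eq_add_of_le h3
  rw [hd, pow_add, Int.cast_mul, mul_comm (Int.cast _), mul_assoc]
  exact J.mul_mem_left _ h1

end Transitive

/-- An element whose mark at `K` is the order of `G` or zero, according to whether `K ≤ H`. -/
theorem exists_mark_le (X : Type u) [MulAction G X] [Finite X] (H : Subgroup G) :
    ∃ u : BurnsideRing G X, ∀ (y : X) (K : Subgroup G), K ≤ MulAction.stabilizer G y →
      (K ≤ H → mark y K u = Nat.card G) ∧ (¬ K ≤ H → mark y K u = 0) := by
  -- The class of `G/H × X` has mark `[G : H]` when `K ≤ H` and `0` otherwise; the factor `|H|`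
  -- makes the nonzero value independent of `H`.
  refine ⟨(Nat.card H : ℤ) * ind (MulActionHom.snd G (G ⧸ H) X) 1, fun y K hK => ?_⟩
  have hstab : ∀ z : {z : (G ⧸ H) × X // MulActionHom.snd G (G ⧸ H) X z = y},
      K ≤ MulAction.stabilizer G z.1 ↔ K ≤ H := by
    rintro ⟨⟨z, c⟩, hc⟩
    obtain rfl : c = y := hc
    refine forall₂_congr fun g hg => ?_
    rw [MulAction.mem_stabilizer_iff, Prod.smul_mk, Prod.mk.injEq,
      ← MulAction.mem_stabilizer_iff, stabilizer_quotient_eq]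
    exact and_iff_left (hK hg)
  have hfib : {z : (G ⧸ H) × X // MulActionHom.snd G (G ⧸ H) X z = y} ≃ G ⧸ H :=
    { toFun := fun z => z.1.1
      invFun := fun z => ⟨(z, y), rfl⟩
      left_inv := by
        rintro ⟨⟨z, c⟩, hc⟩
        obtain rfl : c = y := hc
        rfl
      right_inv := fun _ => rfl }
  have := Fintype.ofFinite {z : (G ⧸ H) × X // MulActionHom.snd G (G ⧸ H) X z = y}
  rw [mark_intCast_mul, mark_ind, finsum_eq_sum_of_fintype]
  refine ⟨fun hKH => ?_, fun hKH => ?_⟩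
  · rw [Finset.sum_congr rfl fun z _ => mark_one ((hstab z).2 hKH), Finset.sum_const,
      Finset.card_univ, ← Nat.card_eq_fintype_card, Nat.card_congr hfib,
      Subgroup.card_eq_card_quotient_mul_card_subgroup H, nsmul_one, Nat.cast_mul, mul_comm]
  · rw [Finset.sum_eq_zero fun z _ => mark_eq_zero (fun h => hKH ((hstab z).1 h)) _, mul_zero]

end BurnsideRing

/-! ### The chain of subgroups of a cyclic `p`-group -/

section Subgroups

variable {G : Type u} [CommGroup G]

theorem mem_subH {p k : ℕ} {g : G} : g ∈ subH G p k ↔ g ^ p ^ k = 1 := by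
  rw [subH, MonoidHom.mem_ker, powMonoidHom_apply]

theorem subH_zero (p : ℕ) : subH G p 0 = ⊥ := by
  ext g
  rw [mem_subH, pow_zero, pow_one, Subgroup.mem_bot]

theorem subH_mono (p : ℕ) {i j : ℕ} (h : i ≤ j) : subH G p i ≤ subH G p j := fun g hg => by
  obtain ⟨d, rfl⟩ := Nat.exists_eq_add_of_le h
  rw [mem_subH] at hg ⊢
  rw [pow_add, pow_mul, hg, one_pow]

variable {p r : ℕ}

theorem subH_eq_top (hG : Nat.card G = p ^ r) : subH G p r = ⊤ := by
  ext g
  rw [mem_subH, ← hG, pow_card_eq_one']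
  simp

variable [Finite G] [IsCyclic G]

theorem card_subH (hG : Nat.card G = p ^ r) {k : ℕ} (hk : k ≤ r) :
    Nat.card (subH G p k) = p ^ k := by
  rw [subH, IsCyclic.card_powMonoidHom_ker, hG]
  exact Nat.gcd_eq_right (pow_dvd_pow p hk)

theorem exists_eq_subH (hp : p.Prime) (hG : Nat.card G = p ^ r) (K : Subgroup G) :
    ∃ k ≤ r, K = subH G p k := by
  obtain ⟨k, hk, hK⟩ := (Nat.dvd_prime_pow hp).1 (hG ▸ Subgroup.card_subgroup_dvd_card K)
  refine ⟨k, hk, Subgroup.eq_of_le_of_card_ge (fun g hg => ?_) (by rw [card_subH hG hk, hK])⟩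
  rw [mem_subH, ← hK]
  exact congrArg Subtype.val (pow_card_eq_one' (x := (⟨g, hg⟩ : K)))

theorem subH_le_subH_iff (hp : p.Prime) (hG : Nat.card G = p ^ r) {i j : ℕ} (hi : i ≤ r)
    (hj : j ≤ r) : subH G p i ≤ subH G p j ↔ i ≤ j := by
  refine ⟨fun h => ?_, subH_mono p⟩
  have h1 := Subgroup.card_le_of_le h
  rw [card_subH hG hi, card_subH hG hj] at h1
  exact (Nat.pow_le_pow_iff_right hp.one_lt).1 h1

theorem subH_succ_le_of_not_le (hp : p.Prime) (hG : Nat.card G = p ^ r) {K : Subgroup G} {i : ℕ}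
    (h : ¬ K ≤ subH G p i) : subH G p (i + 1) ≤ K := by
  obtain ⟨k, hk, rfl⟩ := exists_eq_subH hp hG K
  refine subH_mono p ?_
  by_contra hik
  exact h (subH_mono p (by omega))

end Subgroups

/-! ### Prescribed marks and congruences for cyclic `p`-groups -/

namespace BurnsideRing

open GSetOver

variable {G : Type u} [CommGroup G] [Finite G] {p r : ℕ}

/-- The subgroups form a chain, so subtracting the elements of `exists_mark_le` for two consecutive
subgroups isolates one of them. -/
theorem exists_mark_single [IsCyclic G] (hp : p.Prime) (hG : Nat.card G = p ^ r) (X : Type u)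
    [MulAction G X] [Finite X] (K₀ : Subgroup G) :
    ∃ u : BurnsideRing G X, ∀ (y : X) (K : Subgroup G), K ≤ MulAction.stabilizer G y →
      (K = K₀ → mark y K u = Nat.card G) ∧ (K ≠ K₀ → mark y K u = 0) := by
  obtain ⟨j, hj, rfl⟩ := exists_eq_subH hp hG K₀
  obtain ⟨u, hu⟩ := exists_mark_le X (subH G p j)
  rcases j with _ | j
  · refine ⟨u, fun y K hK => ⟨fun h => (hu y K hK).1 h.le, fun h => (hu y K hK).2 fun h' => h ?_⟩⟩
    rw [subH_zero, le_bot_iff] at h'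
    rw [h', subH_zero]
  · obtain ⟨v, hv⟩ := exists_mark_le X (subH G p j)
    refine ⟨u - v, fun y K hK => ⟨?_, fun h => ?_⟩⟩
    · rintro rfl
      rw [map_sub, (hu y _ hK).1 le_rfl, (hv y _ hK).2, sub_zero]
      rw [subH_le_subH_iff hp hG hj (by omega)]
      omega
    · rw [map_sub]
      by_cases h1 : K ≤ subH G p j
      · rw [(hv y K hK).1 h1, (hu y K hK).1 (h1.trans (subH_mono p (Nat.le_succ j))), sub_self]
      · rw [(hv y K hK).2 h1, (hu y K hK).2 fun h2 => h (le_antisymm h2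
          (subH_succ_le_of_not_le hp hG h1)), sub_self]

/-- Every multiple of the order of `G` in the ghost ring comes from the Burnside ring. -/
theorem exists_mark_eq [IsCyclic G] (hp : p.Prime) (hG : Nat.card G = p ^ r) (X : Type u)
    [MulAction G X] [Finite X] (c : Subgroup G → ℤ) :
    ∃ u : BurnsideRing G X, ∀ (y : X) (K : Subgroup G), K ≤ MulAction.stabilizer G y →
      mark y K u = Nat.card G * c K := by
  classical
  have := Fintype.ofFinite (Subgroup G)
  choose e he using exists_mark_single hp hG X
  refine ⟨∑ K, (c K : BurnsideRing G X) * e K, fun y K hK => ?_⟩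
  rw [map_sum, Finset.sum_eq_single K]
  · rw [mark_intCast_mul, (he K y K hK).1 rfl, mul_comm]
  · intro K' _ h
    rw [mark_intCast_mul, (he K' y K hK).2 h.symm, mul_zero]
  · exact fun h => (h (Finset.mem_univ K)).elim

/-- For a `p`-group, all marks are congruent modulo `p`. -/
theorem dvd_mark_sub_mark_bot [Fact p.Prime] {G : Type u} [Group G] [Finite G] (hG : IsPGroup p G)
    {X : Type u} [MulAction G X] [Finite X] (a : BurnsideRing G X) {x : X} {K : Subgroup G}
    (hK : K ≤ MulAction.stabilizer G x) : (p : ℤ) ∣ mark x K a - mark x ⊥ a := by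
  have key : ∀ A : GSetOver G X, (p : ℤ) ∣ mark x K (cls A) - mark x ⊥ (cls A) := by
    intro A
    let F : SubMulAction K A.carrier :=
      { carrier := {a | A.map a = x}
        smul_mem' := fun g a (ha : A.map a = x) => by
          change A.map ((g : G) • a) = x
          rw [map_smul, ha]
          exact hK g.2 }
    have h1 := (hG.to_subgroup K).card_modEq_card_fixedPoints F
    have e1 : F ≃ A.fixedFiber x ⊥ := Equiv.subtypeEquivRight fun a =>
      ⟨fun h => ⟨h, fun g hg => by rw [Subgroup.mem_bot.1 hg, one_smul]⟩, fun h => h.1⟩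
    have e2 : MulAction.fixedPoints K F ≃ A.fixedFiber x K :=
      { toFun := fun z => ⟨z.1.1, z.1.2, fun g hg => congrArg Subtype.val (z.2 ⟨g, hg⟩)⟩
        invFun := fun z => ⟨⟨z.1, z.2.1⟩, fun g => Subtype.ext (z.2.2 g g.2)⟩
        left_inv := fun _ => rfl
        right_inv := fun _ => rfl }
    rw [Nat.card_congr e1, Nat.card_congr e2] at h1
    rw [mark_cls, mark_cls]
    exact (Nat.modEq_iff_dvd).1 h1
  obtain ⟨A, B, rfl⟩ := exists_eq_cls_sub a
  rw [map_sub, map_sub, sub_sub_sub_comm]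
  exact dvd_sub (key A) (key B)

end BurnsideRing

namespace BurnsideRing

open GSetOver

variable {G : Type u} [Group G] [Finite G] {X Y : Type u} [MulAction G X] [MulAction G Y]
  [Finite X] [Finite Y]

/-- Over a nonempty fibre the mark of `f_• n` is `n` to the number of `K`-orbits, which is positive;
over an empty fibre the difference vanishes. -/
theorem dvd_mark_jnd_intCast (f : X →[G] Y) (n : ℤ) (y : Y) (K : Subgroup G) :
    n ∣ mark y K (jnd f (n : BurnsideRing G X) - jnd f 0) := by
  by_cases hK : K ≤ MulAction.stabilizer G y
  · rw [map_sub]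
    by_cases hy : ∃ x, f x = y
    · obtain ⟨x, hx⟩ := hy
      have := fiberOrbits_nonempty f hx hK
      rw [mark_jnd_zero f hx hK, sub_zero,
        mark_jnd_eq_pow f _ hK fun x _ => mark_intCast inf_le_right n]
      exact dvd_pow_self n Nat.card_pos.ne'
    · rw [mark_jnd_of_isEmpty f _ hK (not_exists.1 hy),
        mark_jnd_of_isEmpty f _ hK (not_exists.1 hy), sub_self]
      exact dvd_zero n
  · rw [mark_eq_zero hK]
    exact dvd_zero n

end BurnsideRing

/-! ### Classification of the prime ideals -/

namespace BurnsideIdeal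

open BurnsideRing

variable {G : Type u} [CommGroup G] [Finite G]

theorem mem_markIdeal_of_isPretransitive {H : Subgroup G} {q : Ideal ℤ} {X : FinGSet G}
    [MulAction.IsPretransitive G X] (y : X) {a : BurnsideRing G X}
    (h : ∀ K ≤ MulAction.stabilizer G y, K ≤ H → mark y K a ∈ q) :
    a ∈ (markIdeal H q).ideal X := by
  intro x K hKH
  obtain ⟨g, rfl⟩ := MulAction.exists_smul_eq G y x
  rw [mark_smul]
  by_cases hK : K ≤ MulAction.stabilizer G y
  · exact h K hK hKH
  · rw [mark_eq_zero hK]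
    exact q.zero_mem

/-- If one element `a_K` is taken for each `K`, then `∏ (a_K - mark y K a_K)` has all marks zero and
so vanishes. As the marks are divisible by `n`, expanding puts `∏ a_K` in `(n)`. -/
theorem markIdeal_top_pow_le (n : ℤ) (X : FinGSet G) [MulAction.IsPretransitive G X] (y : X) :
    (markIdeal ⊤ (Ideal.span {n})).ideal X ^ Nat.card (Subgroup G) ≤
      Ideal.span {(n : BurnsideRing G X)} := by
  classical
  have := Fintype.ofFinite (Subgroup G)
  -- The product is built one subgroup at a time: `Z T` records the part of it whose marks at the
  -- subgroups in `T` have already been killed.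
  let Z : Finset (Subgroup G) → Ideal (BurnsideRing G X) := fun T =>
    { carrier := {u | ∀ K ∈ T, mark y K u = 0}
      add_mem' := fun ha hb K hK => by rw [map_add, ha K hK, hb K hK, add_zero]
      zero_mem' := fun K _ => map_zero _
      smul_mem' := fun c a ha K hK => by rw [smul_eq_mul, mark_mul, ha K hK, mul_zero] }
  have key : ∀ T : Finset (Subgroup G), (markIdeal ⊤ (Ideal.span {n})).ideal X ^ T.card ≤
      Ideal.span {(n : BurnsideRing G X)} ⊔ Z T := by
    intro T
    induction T using Finset.induction_on with
    | empty =>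
      refine le_sup_of_le_right fun u _ K hK => ?_
      simp at hK
    | insert K T hKT ih =>
      rw [Finset.card_insert_of_notMem hKT, pow_succ, Ideal.mul_le]
      intro u hu a ha
      obtain ⟨s, hs, z, hz, rfl⟩ := Submodule.mem_sup.1 (ih hu)
      obtain ⟨d, hd⟩ := Ideal.mem_span_singleton.1 (ha y K le_top)
      have h1 : (s + z) * a = (s * a + (n : BurnsideRing G X) * (d * z)) +
          z * (a - (mark y K a : BurnsideRing G X)) := by
        rw [hd, Int.cast_mul]
        ring
      rw [h1]
      refine Submodule.add_mem_sup (Ideal.add_mem _ (Ideal.mul_mem_right _ _ hs)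
        (Ideal.mul_mem_right _ _ (Ideal.mem_span_singleton_self _))) ?_
      intro L hL
      rw [mark_mul]
      rcases Finset.mem_insert.1 hL with rfl | hL
      · by_cases hLy : L ≤ MulAction.stabilizer G y
        · rw [map_sub, mark_intCast hLy, sub_self, mul_zero]
        · rw [mark_eq_zero hLy, zero_mul]
      · rw [hz L hL, zero_mul]
  have hZ : Z Finset.univ = ⊥ := by
    rw [eq_bot_iff]
    intro u hu
    refine (Submodule.mem_bot _).2 (ext_mark_of_isPretransitive y fun K _ => ?_)
    rw [hu K (Finset.mem_univ K), map_zero]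
  have h := key Finset.univ
  rwa [hZ, sup_bot_eq, Finset.card_univ, ← Nat.card_eq_fintype_card] at h

theorem isTransitive_quotient (H : Subgroup G) : (FinGSet.of (G := G) (G ⧸ H)).IsTransitive :=
  ⟨⟨((1 : G) : G ⧸ H)⟩, inferInstance⟩

/-- The integers in the value of `I` at `G/e`. -/
noncomputable def charIdeal (I : BurnsideIdeal G) : Ideal ℤ :=
  (I.ideal (FinGSet.of (G ⧸ (⊥ : Subgroup G)))).comap
    (Int.castRingHom (BurnsideRing G (G ⧸ (⊥ : Subgroup G))))

/-- Spreading `n` from `G/e` gives an element of `I` all of whose marks are powers of `n`, so a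
power of `n` lies in `I`. Together with `markIdeal_top_pow_le` this bounds a power of the mark
ideal, with an exponent independent of `X`, as `IsPrime.le_of_pow_le` requires. -/
theorem IsPrime.markIdeal_span_le {I : BurnsideIdeal G} (hI : I.IsPrime) {n : ℤ}
    (hn : n ∈ I.charIdeal) : markIdeal ⊤ (Ideal.span {n}) ≤ I := by
  refine hI.le_of_pow_le (Nat.card (Subgroup G) * (Nat.card (Subgroup G) * Nat.card G))
    fun X hX => ?_
  obtain ⟨⟨y⟩, hX⟩ := hX
  rw [pow_mul]
  refine (Ideal.pow_right_mono (markIdeal_top_pow_le n X y) _).trans ?_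
  rw [Ideal.span_singleton_pow, Ideal.span_singleton_le_iff_mem, ← Int.cast_pow,
    ← mul_one (Int.cast _)]
  have h0 : (⊥ : Subgroup G) ≤ MulAction.stabilizer G ((1 : G) : G ⧸ (⊥ : Subgroup G)) := bot_le
  refine intCast_pow_mul_mem _ y (I.spread_mem (Ideal.mem_comap.1 hn) h0 X) n _ fun K hK =>
    Or.inr ?_
  obtain ⟨e, he, h⟩ := mark_spread h0 (C := X) ((Int.castRingHom _) n) (bot_le : ⊥ ≤ K) hK
  refine ⟨e, he, h.trans ?_⟩
  rw [Int.coe_castRingHom, mark_intCast h0]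

/-- Over `G/e` the only marks are those at the trivial subgroup, so pulling `a` back along `G/e → X`
through `x` gives the integer `mark x ⊥ a`. -/
theorem le_markIdeal_charIdeal (I : BurnsideIdeal G) : I ≤ markIdeal ⊥ I.charIdeal := by
  intro X a ha x K hK
  obtain rfl := le_bot_iff.1 hK
  refine Ideal.mem_comap.2 ?_
  have h0 : (⊥ : Subgroup G) ≤ MulAction.stabilizer G x := bot_le
  have h1 : Int.castRingHom (BurnsideRing G (G ⧸ (⊥ : Subgroup G))) (mark x ⊥ a) =
      res (quotientTo h0) a := by
    refine ext_mark fun z K hK => ?_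
    obtain ⟨g, rfl⟩ := QuotientGroup.mk_surjective z
    rw [mark_res _ _ hK, quotientTo_mk, mark_smul, Int.coe_castRingHom, mark_intCast hK]
    rw [stabilizer_quotient_eq, le_bot_iff] at hK
    rw [hK]
  rw [h1]
  exact I.res_mem (FinGSet.of (G ⧸ (⊥ : Subgroup G))) X (quotientTo h0) a ha

/-- All marks of the test products for integers `a` and `b` are divisible by `a * b`. Hence they lie
in `I` as soon as `a * b` does, by `IsPrime.markIdeal_span_le`. -/
theorem IsPrime.charIdeal_isPrime {I : BurnsideIdeal G} (hI : I.IsPrime) :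
    I.charIdeal.IsPrime := by
  refine ⟨fun h => ?_, fun {a b} hab => ?_⟩
  · obtain ⟨X, hX⟩ := hI.1
    have h1 := le_def.1 (hI.markIdeal_span_le (n := 1) (h ▸ Submodule.mem_top)) X
    refine hX (eq_top_iff.2 fun u _ => h1 fun x K _ => ?_)
    rw [Ideal.span_singleton_one]
    exact Submodule.mem_top
  · have h1 := hI.markIdeal_span_le hab
    have hE := isTransitive_quotient (⊥ : Subgroup G)
    refine (hI.2 _ _ hE hE ((Int.castRingHom _) a) ((Int.castRingHom _) b)).1 ?_
    intro C D D' v w v' w'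
    refine le_def.1 h1 C fun y K _ => ?_
    rw [mark_mul, Ideal.mem_span_singleton]
    simp only [Int.coe_castRingHom, map_intCast]
    exact mul_dvd_mul (dvd_mark_jnd_intCast v a y K) (dvd_mark_jnd_intCast v' b y K)

theorem IsPrime.markIdeal_top_charIdeal_le {I : BurnsideIdeal G} (hI : I.IsPrime) :
    markIdeal ⊤ I.charIdeal ≤ I := by
  obtain ⟨n, hn⟩ := (IsPrincipalIdealRing.principal I.charIdeal).principal
  have hn' : I.charIdeal = Ideal.span {n} := hn
  rw [hn']
  exact hI.markIdeal_span_le (hn' ▸ Ideal.mem_span_singleton_self n)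

variable [IsCyclic G] {p r : ℕ}

/-- Some `b` in `I` has a mark `β` outside `q = I.charIdeal` at a subgroup `K₀` of `H_{i+1}`. Every
`K` not inside `H_i` contains `K₀`, so spreads of `b` have powers of `β` as marks there. This
disposes of the marks outside `H_i` up to a factor `γ` built from `β` and `|G|`, and primality
removes `γ`. -/
theorem IsPrime.markIdeal_subH_le {I : BurnsideIdeal G} (hI : I.IsPrime) (hp : p.Prime)
    (hG : Nat.card G = p ^ r) (hpI : (p : ℤ) ∉ I.charIdeal) {i : ℕ}
    (hi' : ¬ I ≤ markIdeal (subH G p (i + 1)) I.charIdeal) :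
    markIdeal (subH G p i) I.charIdeal ≤ I := by
  have hq := hI.charIdeal_isPrime
  obtain ⟨X, b, hb, x, K₀, hK₀, hβ⟩ : ∃ X, ∃ b ∈ I.ideal X, ∃ x, ∃ K ≤ subH G p (i + 1),
      mark x K b ∉ I.charIdeal := by
    by_contra! h
    exact hi' fun X b hb x K hK => h X b hb x K hK
  have hx : K₀ ≤ MulAction.stabilizer G x := by
    by_contra hx
    exact hβ (mark_eq_zero hx b ▸ Submodule.zero_mem _)
  have hK₀' : ∀ K, ¬ K ≤ subH G p i → K₀ ≤ K := fun K hK =>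
    hK₀.trans (subH_succ_le_of_not_le hp hG hK)
  set β := mark x K₀ b
  set M := Nat.card (Subgroup G) * Nat.card G
  -- The factor `|G|` lets ghost vectors be realized by `exists_mark_eq`, and `β ^ M` is the
  -- multiplier produced by `intCast_pow_mul_mem` with `E = |G|`. Since `|G|` is a power of `p` and
  -- `p ∉ q`, `γ` is outside the prime `q`.
  set γ : ℤ := Nat.card G * β ^ M with hγ
  have hγI : γ ∉ I.charIdeal := by
    rw [hγ, hG, Nat.cast_pow]
    exact fun h => (hq.mem_or_mem h).elim (fun h => hpI (hq.mem_of_pow_mem _ h))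
      fun h => hβ (hq.mem_of_pow_mem _ h)
  have hβM : β ^ M ≠ 0 := fun h => hβ (hq.mem_of_pow_mem M (h ▸ Submodule.zero_mem _))
  intro Y a ha
  refine I.mem_of_orbits Y a fun P => ?_
  refine ((hI.2 _ _ (isTransitive_quotient ⊥) (isTransitive_orbit P) ((Int.castRingHom _) γ)
    _).1 ?_).resolve_left hγI
  intro C D D' v w v' w'
  have ha' := (markIdeal (subH G p i) I.charIdeal).jnd_mem _ _ v' _
    ((markIdeal (subH G p i) I.charIdeal).res_mem _ _ w' _
      ((markIdeal (subH G p i) I.charIdeal).res_mem (FinGSet.of P.orbit) _ (orbitIncl P) a ha))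
  generalize jnd v' (res w' (res (orbitIncl P) a)) - jnd v' 0 = z at ha' ⊢
  have hγdvd := dvd_mark_jnd_intCast v γ
  rw [Int.coe_castRingHom, map_intCast]
  generalize jnd v (γ : BurnsideRing G D) - jnd v 0 = t at hγdvd ⊢
  refine I.mem_of_orbits C _ fun O => ?_
  obtain ⟨y, hy⟩ := MulAction.orbitRel.Quotient.nonempty_orbit O
  set u := res (orbitIncl O) (t * z) with hu
  have humark : ∀ K ≤ MulAction.stabilizer G (⟨y, hy⟩ : O.orbit),
      mark ⟨y, hy⟩ K u = mark y K t * mark y K z := fun K hK => by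
    rw [hu, mark_res _ _ hK, mark_mul]
    rfl
  -- Split `u` as `β ^ M * u' + (u - β ^ M * u')`. The marks of the first term vanish inside `H_i`
  -- and equal those of `u` outside, which are divisible by `γ`. The remainder has marks in `q`
  -- everywhere, so `markIdeal ⊤ q ≤ I` applies to it.
  obtain ⟨u', hu'⟩ := exists_mark_eq hp hG O.orbit
    fun K => open Classical in if K ≤ subH G p i then 0 else mark (⟨y, hy⟩ : O.orbit) K u / γ
  have h1 : ((β ^ M : ℤ) : BurnsideRing G O.orbit) * u' ∈ I.ideal (FinGSet.of O.orbit) := by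
    refine intCast_pow_mul_mem (I.ideal (FinGSet.of O.orbit)) (⟨y, hy⟩ : O.orbit)
      (I.spread_mem hb hx (FinGSet.of O.orbit)) β (Nat.card G) fun K hK => ?_
    by_cases hKi : K ≤ subH G p i
    · left
      rw [hu' _ K hK, if_pos hKi, mul_zero]
    · right
      exact mark_spread hx b (hK₀' K hKi) hK
  have h2 : u - ((β ^ M : ℤ) : BurnsideRing G O.orbit) * u' ∈ I.ideal (FinGSet.of O.orbit) := by
    refine le_def.1 hI.markIdeal_top_charIdeal_le (FinGSet.of O.orbit)
      (mem_markIdeal_of_isPretransitive (X := FinGSet.of O.orbit) (⟨y, hy⟩ : O.orbit)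
        fun K hK _ => ?_)
    rw [map_sub, mark_intCast_mul, hu' _ K hK]
    by_cases hKi : K ≤ subH G p i
    · rw [if_pos hKi, mul_zero, mul_zero, sub_zero, humark K hK]
      exact Ideal.mul_mem_left _ _ (ha' y K hKi)
    · have h3 : γ ∣ mark (⟨y, hy⟩ : O.orbit) K u := by
        rw [humark K hK]
        exact (hγdvd y K).mul_right _
      rw [if_neg hKi, ← mul_assoc, mul_comm (β ^ M), Int.mul_ediv_cancel' h3, sub_self]
      exact Submodule.zero_mem _
  have h3 := Ideal.add_mem _ h1 h2
  rwa [add_sub_cancel] at h3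

/-- Every prime ideal of the Burnside Tambara functor is given by marks. -/
theorem IsPrime.exists_eq_markIdeal {I : BurnsideIdeal G} (hI : I.IsPrime) (hp : p.Prime)
    (hG : Nat.card G = p ^ r) : ∃ i ≤ r, I = markIdeal (subH G p i) I.charIdeal ∧
      ((p : ℤ) ∈ I.charIdeal → i = 0) := by
  have hlow := hI.markIdeal_top_charIdeal_le
  have hup := I.le_markIdeal_charIdeal
  by_cases hpI : (p : ℤ) ∈ I.charIdeal
  · refine ⟨0, Nat.zero_le r, ?_, fun _ => rfl⟩
    rw [subH_zero]
    -- Each mark differs from the mark at the trivial subgroup by a multiple of `p`, so the lower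
    -- and upper bounds coincide.
    refine le_antisymm hup (le_trans (b := markIdeal ⊤ I.charIdeal) ?_ hlow)
    intro X a ha x K _
    by_cases hK : K ≤ MulAction.stabilizer G x
    · have := Fact.mk hp
      rw [← sub_add_cancel (mark x K a) (mark x ⊥ a)]
      exact Ideal.add_mem _ (Ideal.mem_of_dvd _
        (dvd_mark_sub_mark_bot (IsPGroup.of_card hG) a hK) hpI) (ha x ⊥ le_rfl)
    · rw [mark_eq_zero hK]
      exact Submodule.zero_mem _
  -- Increase `i` from `0`, where the upper bound holds, until the inclusion fails at `i + 1` or `i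
  -- = r`. In the latter case `H_r = G` and the lower bound finishes.
  · have key : ∀ d i, i + d = r → I ≤ markIdeal (subH G p i) I.charIdeal →
        ∃ i ≤ r, I = markIdeal (subH G p i) I.charIdeal := by
      intro d
      induction d with
      | zero =>
        rintro i rfl h
        refine ⟨i, le_rfl, le_antisymm h ?_⟩
        rwa [add_zero, ← subH_eq_top hG] at *
      | succ d ih =>
        intro i hi h
        by_cases h' : I ≤ markIdeal (subH G p (i + 1)) I.charIdeal
        · exact ih (i + 1) (by omega) h'
        · exact ⟨i, by omega, le_antisymm h (hI.markIdeal_subH_le hp hG hpI h')⟩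
    obtain ⟨i, hi, h⟩ := key r 0 (Nat.zero_add r) (by rwa [subH_zero])
    exact ⟨i, hi, h, fun h' => (hpI h').elim⟩

end BurnsideIdeal

/-! ### The operations `L` and `S` on mark ideals -/

section QuotientProj

variable {G : Type u} [CommGroup G] {p k : ℕ}

theorem quotientProj_surjective {K H : Subgroup G} (h : K ≤ H) :
    Function.Surjective (quotientProj h) := fun y => by
  obtain ⟨g, rfl⟩ := QuotientGroup.mk_surjective y
  exact ⟨(g : G ⧸ K), rfl⟩

theorem quotientProj_eq_iff {K H : Subgroup G} (h : K ≤ H) {x x' : G ⧸ K} :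
    quotientProj h x = quotientProj h x' ↔ ∃ g ∈ H, g • x' = x := by
  obtain ⟨a, rfl⟩ := QuotientGroup.mk_surjective x
  obtain ⟨b, rfl⟩ := QuotientGroup.mk_surjective x'
  have h1 : quotientProj h (a : G ⧸ K) = quotientProj h (b : G ⧸ K) ↔
      (a : G ⧸ H) = (b : G ⧸ H) := Iff.rfl
  rw [h1, eq_comm, QuotientGroup.eq]
  constructor
  · intro h2
    refine ⟨b⁻¹ * a, h2, ?_⟩
    rw [MulAction.Quotient.smul_mk, smul_eq_mul, mul_comm, mul_inv_cancel_left]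
  · rintro ⟨g, hg, h2⟩
    rw [MulAction.Quotient.smul_mk, QuotientGroup.eq, smul_eq_mul] at h2
    have h3 := H.mul_mem hg (h h2)
    rwa [mul_inv_rev, mul_assoc, mul_comm, mul_assoc, mul_assoc, mul_comm a,
      inv_mul_cancel_left] at h3

end QuotientProj

namespace BurnsideIdeal

open BurnsideRing GSetOver

variable {G : Type u} [CommGroup G] [Finite G]

theorem jnd_zero_of_surjective {X Y : Type u} [MulAction G X] [MulAction G Y] [Finite X]
    [Finite Y] {f : X →[G] Y} (hf : Function.Surjective f) :
    jnd f (0 : BurnsideRing G X) = 0 := by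
  refine ext_mark fun y K hK => ?_
  obtain ⟨x, hx⟩ := hf y
  rw [mark_jnd_zero f hx hK, map_zero]

variable {p r : ℕ}

/-- Only marks at `K ≤ H_m ≤ H_k` matter. Such `K` stabilize the points of `G/H_k`, so restriction
to that level loses none of them. -/
theorem extL_markIdeal {q : Ideal ℤ} {m k : ℕ} (hmk : m ≤ k) :
    extL ((markIdeal (subH G p m) q).ideal (FinGSet.of (G ⧸ subH G p k))) =
      (markIdeal (subH G p m) q).ideal (FinGSet.of (G ⧸ subH G p (k + 1))) := by
  refine le_antisymm (fun a ha y K hK => ?_) fun a ha =>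
    (markIdeal _ q).res_mem (FinGSet.of _) (FinGSet.of _) _ a ha
  obtain ⟨x, rfl⟩ := quotientProj_surjective (subH_le_succ G p k) y
  have h1 := ha x K hK
  rwa [mark_res _ _ ((hK.trans (subH_mono p hmk)).trans (stabilizer_quotient_eq _ x).ge)] at h1

theorem le_of_markIdeal_le {q q' : Ideal ℤ} {H H' : Subgroup G}
    (h : markIdeal H q ≤ markIdeal H' q') : q ≤ q' := by
  intro n hn
  have h1 : ((n : ℤ) : BurnsideRing G (G ⧸ (⊥ : Subgroup G))) ∈
      (markIdeal H q).ideal (FinGSet.of (G ⧸ (⊥ : Subgroup G))) := by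
    intro x K _
    by_cases hK : K ≤ MulAction.stabilizer G x
    · rwa [mark_intCast hK]
    · rw [mark_eq_zero hK]
      exact q.zero_mem
  have h2 := h (FinGSet.of (G ⧸ (⊥ : Subgroup G))) h1 ((1 : G) : G ⧸ (⊥ : Subgroup G)) ⊥ bot_le
  rwa [mark_intCast bot_le] at h2

theorem markIdeal_top_bot (X : FinGSet G) : (markIdeal (⊤ : Subgroup G) ⊥).ideal X = ⊥ := by
  refine eq_bot_iff.2 fun a ha => (Submodule.mem_bot _).2 (ext_mark fun x K _ => ?_)
  rw [map_zero]
  exact (Submodule.mem_bot ℤ).1 (ha x K le_top)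

variable [IsCyclic G]

theorem card_quotientProj_fiber (hp : p.Prime) (hG : Nat.card G = p ^ r) {k : ℕ} (hk : k < r)
    (y : G ⧸ subH G p (k + 1)) :
    Nat.card {x // quotientProj (subH_le_succ G p k) x = y} = p := by
  obtain ⟨x, rfl⟩ := quotientProj_surjective (subH_le_succ G p k) y
  have h1 : {x' | quotientProj (subH_le_succ G p k) x' = quotientProj (subH_le_succ G p k) x} =
      MulAction.orbit (subH G p (k + 1)) x := by
    ext x'
    refine (quotientProj_eq_iff _).trans ⟨?_, ?_⟩
    · rintro ⟨g, hg, h⟩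
      exact ⟨⟨g, hg⟩, h⟩
    · rintro ⟨g, h⟩
      exact ⟨g, g.2, h⟩
  have h2 : MulAction.stabilizer (subH G p (k + 1)) x =
      (subH G p k).subgroupOf (subH G p (k + 1)) := by
    ext g
    exact SetLike.ext_iff.1 (stabilizer_quotient_eq (subH G p k) x) (g : G)
  have h3 := Nat.card_congr (MulAction.orbitProdStabilizerEquivGroup (subH G p (k + 1)) x)
  rw [Nat.card_prod, h2,
    Nat.card_congr (Subgroup.subgroupOfEquivOfLe (subH_le_succ G p k)).toEquiv,
    card_subH hG hk.le, card_subH hG hk, pow_succ, mul_comm] at h3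
  have h4 := Nat.eq_of_mul_eq_mul_left (pow_pos hp.pos k) h3
  rwa [← h1] at h4

/-- When all marks of `a` are divisible by `q`, the quotients times `|G|` are the marks of some `w`,
so `q * w = |G| * a`. As `|G|` is prime to `q`, a Bézout relation gives `a ∈ (q)`. -/
theorem markIdeal_ideal_eq_span (hp : p.Prime) (hG : Nat.card G = p ^ r) {q : ℕ} (hq : q.Prime)
    (hqp : q ≠ p) {H : Subgroup G} (X : FinGSet G) [MulAction.IsPretransitive G X] (y : X)
    (hy : MulAction.stabilizer G y ≤ H) :
    (markIdeal H (Ideal.span {(q : ℤ)})).ideal X = Ideal.span {(q : BurnsideRing G X)} := by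
  refine le_antisymm (fun a ha => ?_) ?_
  · obtain ⟨w, hw⟩ := exists_mark_eq hp hG X fun K => mark y K a / q
    have h1 : (q : BurnsideRing G X) * w = (Nat.card G : BurnsideRing G X) * a := by
      refine ext_mark_of_isPretransitive y fun K hK => ?_
      have h2 : (q : ℤ) ∣ mark y K a := Ideal.mem_span_singleton.1 (ha y K (hK.trans hy))
      rw [← Int.cast_natCast, ← Int.cast_natCast (Nat.card G), mark_intCast_mul,
        mark_intCast_mul, hw y K hK, mul_left_comm, Int.mul_ediv_cancel' h2]
    have h2 : IsCoprime (q : ℤ) (Nat.card G : ℤ) := by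
      rw [hG, Nat.isCoprime_iff_coprime]
      exact Nat.Coprime.pow_right r ((Nat.coprime_primes hq hp).2 hqp)
    obtain ⟨s, t, hst⟩ := h2
    have h3 : (s : BurnsideRing G X) * q + t * Nat.card G = 1 := by
      have h4 := congrArg (Int.cast : ℤ → BurnsideRing G X) hst
      exact_mod_cast h4
    refine Ideal.mem_span_singleton.2 ⟨s * a + t * w, ?_⟩
    linear_combination (-(a : BurnsideRing G X)) * h3 - (t : BurnsideRing G X) * h1
  · rw [Ideal.span_singleton_le_iff_mem]
    intro x K _
    by_cases hK : K ≤ MulAction.stabilizer G x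
    · rw [← Int.cast_natCast (R := BurnsideRing G X), mark_intCast hK]
      exact Ideal.mem_span_singleton_self _
    · rw [mark_eq_zero hK]
      exact Submodule.zero_mem _

/-- By Fermat `q ^ (p - 1) = 1 + p * c`, and then `q = ind (-c * q) + jnd q`. At `K ≤ H_k` the fibre
is `p` fixed points and the marks read `q = -p * c * q + q ^ p`. At `K = H_{k+1}` it is one orbit
without fixed points and they read `q = 0 + q`. -/
theorem natCast_mem_extS_span (hp : p.Prime) (hG : Nat.card G = p ^ r) {q : ℕ} (hq : q.Prime)
    (hqp : q ≠ p) {k : ℕ} (hk : k < r) :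
    (q : levelRing G p (k + 1)) ∈ extS (Ideal.span {(q : levelRing G p k)}) := by
  set f := quotientProj (subH_le_succ G p k) with hf
  obtain ⟨c, hc⟩ := (Int.ModEq.pow_card_sub_one_eq_one hp (n := q)
    (Nat.isCoprime_iff_coprime.2 ((Nat.coprime_primes hq hp).2 hqp))).symm.dvd
  have key : (q : levelRing G p (k + 1)) =
      ind f ((-(c * q) : ℤ) : levelRing G p k) + jnd f ((q : ℤ) : levelRing G p k) := by
    refine ext_mark fun y K hK => ?_
    have hcard := card_quotientProj_fiber hp hG hk y
    rw [stabilizer_quotient_eq] at hK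
    have := Fintype.ofFinite {x // f x = y}
    have hjnd := mark_jnd_eq_pow f ((q : ℤ) : levelRing G p k)
      (hK.trans (stabilizer_quotient_eq _ y).ge) fun x _ => mark_intCast inf_le_right (q : ℤ)
    rw [map_add, mark_ind, finsum_eq_sum_of_fintype, hjnd, ← Int.cast_natCast,
      mark_intCast (hK.trans (stabilizer_quotient_eq _ y).ge)]
    by_cases hKk : K ≤ subH G p k
    · have h1 : Nat.card (FiberOrbits f y K) = p := by
        refine le_antisymm ((card_fiberOrbits_le f y K).trans hcard.le) (hcard.ge.trans ?_)
        have h2 : ∀ x x' : G ⧸ subH G p k, Quotient.mk (MulAction.orbitRel K _) x =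
            Quotient.mk (MulAction.orbitRel K _) x' → x = x' := fun x x' h => by
          obtain ⟨g, hg⟩ := MulAction.orbitRel_apply.1 (Quotient.exact h)
          rw [← hg]
          exact hKk.trans (stabilizer_quotient_eq _ x').ge g.2
        refine Nat.card_le_card_of_injective (fun x => ⟨Quotient.mk (MulAction.orbitRel K _) x.1,
          (congrArg f (h2 _ _ (Quotient.out_eq _))).trans x.2⟩) fun x x' h =>
            Subtype.ext (h2 _ _ (congrArg Subtype.val h))
      rw [h1, Finset.sum_congr rfl fun x _ =>
        mark_intCast (hKk.trans (stabilizer_quotient_eq _ x.1).ge) _, Finset.sum_const,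
        Finset.card_univ, ← Nat.card_eq_fintype_card, hcard, nsmul_eq_mul]
      obtain ⟨n, rfl⟩ := Nat.exists_eq_add_of_le' hp.pos
      rw [Nat.add_sub_cancel] at hc
      rw [pow_succ]
      linear_combination (-(q : ℤ)) * hc
    · have h1 : Nat.card (FiberOrbits f y K) = 1 := by
        obtain ⟨x, hx⟩ := quotientProj_surjective (subH_le_succ G p k) y
        have hne := fiberOrbits_nonempty f hx (hK.trans (stabilizer_quotient_eq _ y).ge)
        have hss : Subsingleton (FiberOrbits f y K) := ⟨fun O O' => Subtype.ext ?_⟩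
        · exact Nat.card_unique
        · obtain ⟨g, hg, h⟩ := (quotientProj_eq_iff _).1 (O.2.trans O'.2.symm)
          rw [← Quotient.out_eq O.1, ← Quotient.out_eq O'.1]
          exact Quotient.sound (MulAction.orbitRel_apply.2
            ⟨⟨g, subH_succ_le_of_not_le hp hG hKk hg⟩, h⟩)
      rw [h1, pow_one, Finset.sum_eq_zero fun x _ => mark_eq_zero
        (fun h => hKk (h.trans (stabilizer_quotient_eq _ x.1).le)) _, zero_add]
  rw [key]
  refine Submodule.add_mem_sup (Ideal.subset_span ⟨_, ?_, rfl⟩) (Ideal.subset_span ⟨_, ?_, rfl⟩)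
  · refine Ideal.mem_span_singleton.2 ⟨((-c : ℤ) : levelRing G p k), ?_⟩
    push_cast
    ring
  · rw [Int.cast_natCast]
    exact Ideal.mem_span_singleton_self _

/-- For the inclusion into `(q)`, the ideals `(q)` are the values of the Tambara ideal `markIdeal ⊤
(q)`, which is closed under transfers; the correction term `f_• 0` is zero since the projection is
surjective. -/
theorem extS_span (hp : p.Prime) (hG : Nat.card G = p ^ r) {q : ℕ} (hq : q.Prime)
    (hqp : q ≠ p) {k : ℕ} (hk : k < r) :
    extS (Ideal.span {(q : levelRing G p k)}) = Ideal.span {(q : levelRing G p (k + 1))} := by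
  refine le_antisymm ?_
    ((Ideal.span_singleton_le_iff_mem _).2 (natCast_mem_extS_span hp hG hq hqp hk))
  have h : ∀ j, (markIdeal ⊤ (Ideal.span {(q : ℤ)})).ideal (FinGSet.of (G ⧸ subH G p j)) =
      Ideal.span {(q : levelRing G p j)} := fun j =>
    markIdeal_ideal_eq_span hp hG hq hqp (FinGSet.of (G ⧸ subH G p j))
      ((1 : G) : G ⧸ subH G p j) le_top
  rw [← h, ← h]
  refine sup_le (Ideal.span_le.2 ?_) (Ideal.span_le.2 ?_)
  · rintro _ ⟨a, ha, rfl⟩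
    exact (markIdeal ⊤ _).ind_mem (FinGSet.of _) (FinGSet.of _) _ a ha
  · rintro _ ⟨a, ha, rfl⟩
    have h1 := (markIdeal ⊤ _).jnd_mem (FinGSet.of _) (FinGSet.of _)
      (quotientProj (subH_le_succ G p k)) a ha
    rwa [jnd_zero_of_surjective (quotientProj_surjective _), sub_zero] at h1

theorem markIdeal_eq_seqLS (hp : p.Prime) (hG : Nat.card G = p ^ r) {q : ℕ} (hq : q.Prime)
    (hqp : q ≠ p) {m k : ℕ} (hk : k ≤ r) :
    (markIdeal (subH G p m) (Ideal.span {(q : ℤ)})).ideal (FinGSet.of (G ⧸ subH G p k)) =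
      seqLS (Ideal.span {(q : levelRing G p 0)}) m k := by
  have h : ∀ j ≤ m, (markIdeal (subH G p m) (Ideal.span {(q : ℤ)})).ideal
      (FinGSet.of (G ⧸ subH G p j)) = Ideal.span {(q : levelRing G p j)} := fun j hj =>
    markIdeal_ideal_eq_span hp hG hq hqp (FinGSet.of (G ⧸ subH G p j))
      ((1 : G) : G ⧸ subH G p j) ((stabilizer_quotient_eq _ _).le.trans (subH_mono p hj))
  induction k with
  | zero => exact h 0 (Nat.zero_le m)
  | succ k ih =>
    rw [seqLS, ← ih (by omega)]
    split_ifs with hkm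
    · rw [h k hkm.le, h (k + 1) hkm, extS_span hp hG hq hqp (by omega)]
    · exact (extL_markIdeal (not_lt.1 hkm)).symm

/-! ### Chains of prime ideals and the dimension -/

theorem index_le_of_markIdeal_le (hp : p.Prime) (hG : Nat.card G = p ^ r) {q q' : Ideal ℤ}
    [hq' : q'.IsPrime] (hpq : (p : ℤ) ∉ q') {i j : ℕ} (hj : j ≤ r)
    (h : markIdeal (subH G p i) q ≤ markIdeal (subH G p j) q') : j ≤ i := by
  by_contra! hij
  have hK : subH G p j ≤ MulAction.stabilizer G ((1 : G) : G ⧸ subH G p j) :=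
    (stabilizer_quotient_eq _ _).ge
  -- The only nonzero marks of `u` are at `H_j`, which is not inside `H_i`, and they equal `p ^ r`,
  -- which is not in `q'`.
  obtain ⟨u, hu⟩ := exists_mark_single hp hG (G ⧸ subH G p j) (subH G p j)
  have h1 : u ∈ (markIdeal (subH G p i) q).ideal (FinGSet.of (G ⧸ subH G p j)) := by
    intro x K hKi
    by_cases hKx : K ≤ MulAction.stabilizer G x
    · rw [(hu x K hKx).2]
      · exact q.zero_mem
      · rintro rfl
        exact absurd ((subH_le_subH_iff hp hG hj (by omega)).1 hKi) (by omega)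
    · rw [mark_eq_zero hKx]
      exact q.zero_mem
  have h2 := h _ h1 ((1 : G) : G ⧸ subH G p j) (subH G p j) le_rfl
  rw [(hu _ _ hK).1 rfl, hG, Nat.cast_pow] at h2
  exact hpq (hq'.mem_of_pow_mem _ h2)

/-- A rank function on the prime spectrum. -/
theorem exists_rank (hp : p.Prime) (hG : Nat.card G = p ^ r) :
    ∃ ν : BurnsideSpec G → ℕ, (∀ P, ν P ≤ r + 1) ∧ ∀ P Q, P < Q → ν Q < ν P := by
  classical
  choose i hi hPi hip using fun P : BurnsideSpec G => P.2.exists_eq_markIdeal hp hG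
  -- Along an inclusion the characteristic grows and the index does not increase; in characteristic
  -- `p` the latter uses the normalization `i = 0`. If the index stays the same, the characteristic
  -- must grow strictly, hence from zero, since nonzero primes of the integers are maximal.
  refine ⟨fun P => i P + if P.1.charIdeal = ⊥ then 1 else 0, fun P => ?_, fun P Q hPQ => ?_⟩
  · have := hi P
    dsimp only
    split_ifs <;> omega
  have hle : markIdeal (subH G p (i P)) P.1.charIdeal ≤
      markIdeal (subH G p (i Q)) Q.1.charIdeal := by
    rw [← hPi, ← hPi]
    exact hPQ.le
  have hq := P.2.charIdeal_isPrime
  have hq' := Q.2.charIdeal_isPrime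
  have h1 : P.1.charIdeal ≤ Q.1.charIdeal := le_of_markIdeal_le hle
  have h2 : i Q ≤ i P := by
    by_cases hpq : (p : ℤ) ∈ Q.1.charIdeal
    · rw [hip Q hpq]
      exact Nat.zero_le _
    · exact index_le_of_markIdeal_le hp hG hpq (hi Q) hle
  have h3 : i Q = i P → P.1.charIdeal ≠ Q.1.charIdeal := fun h h' => hPQ.ne (Subtype.ext (by
    rw [hPi P, hPi Q, h, h']))
  dsimp only
  by_cases hP : P.1.charIdeal = ⊥
  · rw [if_pos hP]
    by_cases hQ : Q.1.charIdeal = ⊥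
    · rw [if_pos hQ]
      have : i Q ≠ i P := fun h => h3 h (hP.trans hQ.symm)
      omega
    · rw [if_neg hQ]
      omega
  · have h4 := (hq.isMaximal hP).eq_of_le hq'.ne_top h1
    have h5 : i Q ≠ i P := fun h => h3 h h4
    rw [if_neg hP, if_neg (h4 ▸ hP)]
    omega

theorem ltSeries_length_le (hp : p.Prime) (hG : Nat.card G = p ^ r)
    (c : LTSeries (BurnsideSpec G)) : c.length ≤ r + 1 := by
  obtain ⟨ν, hν, hlt⟩ := exists_rank (G := G) hp hG
  have hinj : Function.Injective fun i => (⟨ν (c i), Nat.lt_succ_of_le (hν _)⟩ : Fin (r + 2)) := by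
    intro i j hij
    have hij' : ν (c i) = ν (c j) := congrArg Fin.val hij
    rcases lt_trichotomy i j with h | h | h
    · exact absurd hij' (hlt _ _ (c.strictMono h)).ne'
    · exact h
    · exact absurd hij' (hlt _ _ (c.strictMono h)).ne
  have := Fintype.card_le_of_injective _ hinj
  rw [Fintype.card_fin, Fintype.card_fin] at this
  omega

theorem exists_strictMono_seqLS (hp : p.Prime) (hG : Nat.card G = p ^ r) {q : ℕ} (hq : q.Prime)
    (hqp : q ≠ p) : ∃ P : Fin (r + 2) → BurnsideSpec G, StrictMono P ∧
      (∀ X, (P 0).1.ideal X = ⊥) ∧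
      ∀ j : Fin (r + 1), ∀ k ≤ r,
        (P j.succ).1.ideal (FinGSet.of (G ⧸ subH G p k)) =
          seqLS (Ideal.span {(q : levelRing G p 0)}) (r - j) k := by
  have hq0 : (q : ℤ) ≠ 0 := by exact_mod_cast hq.ne_zero
  have hprime : (Ideal.span {(q : ℤ)}).IsPrime :=
    (Ideal.span_singleton_prime hq0).2 (Nat.prime_iff_prime_int.1 hq)
  have hpq : (p : ℤ) ∉ Ideal.span {(q : ℤ)} := fun h =>
    hqp ((Nat.prime_dvd_prime_iff_eq hq hp).1
      (Int.natCast_dvd_natCast.1 (Ideal.mem_span_singleton.1 h)))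
  -- The index `r - j` is the number of `S`-steps, leaving `j` steps of type `L`. The ideal grows
  -- with `j` because fewer marks are constrained.
  let Q : Fin (r + 1) → BurnsideSpec G := fun j =>
    ⟨markIdeal (subH G p (r - j)) (Ideal.span {(q : ℤ)}), markIdeal_isPrime _ _⟩
  let Z : BurnsideSpec G := ⟨markIdeal ⊤ ⊥, markIdeal_isPrime _ _⟩
  refine ⟨Fin.cons Z Q, ?_, markIdeal_top_bot, fun j k hk => markIdeal_eq_seqLS hp hG hq hqp hk⟩
  rw [Fin.strictMono_iff_lt_succ]
  intro i
  rw [Fin.cons_succ]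
  cases i using Fin.cases with
  | zero =>
    refine lt_of_le_not_ge (markIdeal_mono (H := ⊤) le_top bot_le) fun h => hq0 ?_
    exact (Submodule.mem_bot ℤ).1 (le_of_markIdeal_le h (Ideal.mem_span_singleton_self _))
  | succ j =>
    rw [Fin.castSucc_succ, Fin.cons_succ]
    refine lt_of_le_not_ge (markIdeal_mono (subH_mono p ?_) le_rfl) fun h => ?_
    · simp only [Fin.val_succ, Fin.val_castSucc]
      omega
    · have := index_le_of_markIdeal_le hp hG hpq (by omega) h
      simp only [Fin.val_succ, Fin.val_castSucc] at this
      omega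

end BurnsideIdeal

theorem mainTheorem2 {G : Type u} [CommGroup G] [Finite G] [IsCyclic G] (p r : ℕ)
    (hp : p.Prime) (hG : Nat.card G = p ^ r) :
    (∀ c : LTSeries (BurnsideSpec G), c.length ≤ r + 1) ∧
    (∀ q : ℕ, q.Prime → q ≠ p →
      ∃ P : Fin (r + 2) → BurnsideSpec G, StrictMono P ∧
        (∀ X, (P 0).1.ideal X = ⊥) ∧
        ∀ j : Fin (r + 1), ∀ k ≤ r,
          (P j.succ).1.ideal (FinGSet.of (G ⧸ subH G p k)) =
            seqLS (Ideal.span {(q : levelRing G p 0)}) (r - j) k) ∧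
    Order.krullDim (BurnsideSpec G) = ((r + 1 : ℕ) : WithBot ℕ∞) := by
  have hle := BurnsideIdeal.ltSeries_length_le (G := G) hp hG
  refine ⟨hle, fun q hq hqp => BurnsideIdeal.exists_strictMono_seqLS hp hG hq hqp,
    le_antisymm (iSup_le fun c => by exact_mod_cast hle c) ?_⟩
  obtain ⟨q, hq, hqp⟩ : ∃ q : ℕ, q.Prime ∧ q ≠ p := by
    by_cases h : p = 2
    · exact ⟨3, Nat.prime_three, by omega⟩
    · exact ⟨2, Nat.prime_two, Ne.symm h⟩
  obtain ⟨P, hP, -⟩ := BurnsideIdeal.exists_strictMono_seqLS (G := G) hp hG hq hqp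
  exact Order.LTSeries.length_le_krullDim (LTSeries.mk (r + 1) P hP)
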